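/- Setting. Let $N\ge 3$, let $\alpha=(\alpha_1,\dots,\alpha_N)\in\mathbb R^N$, and let $y_1,\dots,y_N\in\mathbb R^2$ be $N$ distinct points. For $z\in\mathbb C^+=\{\operatorname{Im} z>0\}$ let $\mathcal G_z(x)=\frac i4H_0^{(1)}(z|x|)$ be the convolution kernel of $(-\Delta-z^2)^{-1}$ in $L^2(\mathbb R^2)$, and let $\Gamma_{\alpha,Y}(z)$ be the $N\times N$ matrix with diagonal entries $\alpha_j+\frac1{2\pi}\log\frac z2-\frac i4+\frac{\gamma}{2\pi}$ ($\gamma$ is Euler's constant, $\log$ the principal branch) and off-diagonal entries $-\mathcal G_z(y_j-y_k)$. The point-interaction operator $H_{\alpha,Y}$ is the self-adjoint operator in the complex Hilbert space $L^2(\mathbb R^2)$ such that, for every $z\in\mathbb C^+$ with $\Gamma_{\alpha,Y}(z)$ invertible, its domain consists of the functions $$u(x)=v(x)+\sum_{j,k=1}^N[\Gamma_{\alpha,Y}(z)^{-1}]_{jk}\,v(y_k)\,\mathcal G_z(x-y_j),\qquad v\in H^2(\mathbb R^2),$$ and $(H_{\alpha,Y}-z^2)u=(-\Delta-z^2)v$.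 Let $\tilde{\mathcal D}$ be the real symmetric $N\times N$ matrix with diagonal entries $\alpha_j$ and off-diagonal entries $\frac1{2\pi}\log|y_j-y_k|$. Proposition 1.2. (i) If $a\in\mathbb R^N\setminus\{0\}$ satisfies $$\sum_{j=1}^Na_j=0,\qquad \sum_{j=1}^Na_jy_j=0,\qquad \tilde{\mathcal D}a=0,\tag{$*$}$$ then the function $$\psi(x)=-\sum_{j=1}^N\frac{a_j}{2\pi}\log|x-y_j|\tag{$**$}$$ is a nonzero element of $L^2(\mathbb R^2)$, belongs to the domain of $H_{\alpha,Y}$, and satisfies $H_{\alpha,Y}\psi=0$. (ii) Conversely, every real-valued $\psi\ne0$ in the domain of $H_{\alpha,Y}$ with $H_{\alpha,Y}\psi=0$ is (almost everywhere) of the form $(**)$ with some $a\in\mathbb R^N\setminus\{0\}$ satisfying $(*)$; and every complex-valued $\psi\neq 0$ in the domain of $H_{\alpha,Y}$ with $H_{\alpha,Y}\psi=0$ is of the form $(**)$ with some $a\in\mathbb C^N\setminus\{0\}$ satisfying $(*)$. -/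

import Mathlib

open MeasureTheory
open scoped SchwartzMap Laplacian ENNReal

/-- The plane `ℝ²` with its Euclidean norm. -/
abbrev Plane : Type := EuclideanSpace ℝ (Fin 2)

/-- The complex Hilbert space `L²(ℝ²)` (Lebesgue measure). -/
abbrev L2Plane : Type := Lp ℂ 2 (volume : Measure Plane)

noncomputable section

/-- The Hankel function of the first kind and order zero on the open upper half-plane, through
Sommerfeld's integral `H₀⁽¹⁾(w) = (2 / (π i)) ∫₀^∞ exp (i w cosh t) dt`, which converges absolutely
for `Im w > 0`. -/
def hankelZero (w : ℂ) : ℂ :=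
  (2 / ((Real.pi : ℂ) * Complex.I)) *
    ∫ t in Set.Ioi (0 : ℝ), Complex.exp (Complex.I * w * ((Real.cosh t : ℝ) : ℂ))

/-- The convolution kernel `𝒢_z(x) = (i/4) H₀⁽¹⁾(z |x|)` of `(-Δ - z²)⁻¹` in `L²(ℝ²)`, for
`Im z > 0`. It is singular at `x = 0`, where the value given here is of no meaning. -/
def greenKernel (z : ℂ) (x : Plane) : ℂ :=
  (Complex.I / 4) * hankelZero (z * ((‖x‖ : ℝ) : ℂ))

variable {N : ℕ}

/-- The matrix `Γ_{α,Y}(z)`, for `Im z > 0` (principal branch of the logarithm, Euler's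
constant `γ`). -/
def gammaMatrix (α : Fin N → ℝ) (y : Fin N → Plane) (z : ℂ) : Matrix (Fin N) (Fin N) ℂ :=
  Matrix.of fun j k =>
    if j = k then
      (α j : ℂ) + 1 / (2 * (Real.pi : ℂ)) * Complex.log (z / 2) - Complex.I / 4
        + (Real.eulerMascheroniConstant : ℂ) / (2 * (Real.pi : ℂ))
    else -greenKernel z (y j - y k)

/-- The points `z` of the open upper half-plane at which `Γ_{α,Y}(z)` is invertible. -/
def admissible (α : Fin N → ℝ) (y : Fin N → Plane) : Set ℂ :=
  {z | 0 < z.im ∧ IsUnit (gammaMatrix α y z)}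

/-- For `v` the (continuous) `H²` function, the function
`v(x) + ∑_{j,k} [Γ_{α,Y}(z)⁻¹]_{jk} v(y_k) 𝒢_z(x - y_j)`. -/
def domainFunction (α : Fin N → ℝ) (y : Fin N → Plane) (z : ℂ) (v : Plane → ℂ) (x : Plane) : ℂ :=
  v x + ∑ j, ∑ k, (gammaMatrix α y z)⁻¹ j k * v (y k) * greenKernel z (x - y j)

/-- The graph of `H_{α,Y}` described at a point `z`: the pairs `(u, f)` in `L² × L²` for which there
is `v ∈ H²(ℝ²)` (with continuous representative `vc`) such that
`u(x) = v(x) + ∑_{j,k} [Γ_{α,Y}(z)⁻¹]_{jk} v(y_k) 𝒢_z(x - y_j)` almost everywhere and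
`f - z² u = (-Δ - z²) v`, the Laplacian being that of tempered distributions. -/
def pointInteractionGraphAt (α : Fin N → ℝ) (y : Fin N → Plane) (z : ℂ) :
    Submodule ℂ (L2Plane × L2Plane) where
  carrier := {p | ∃ (v : L2Plane) (vc : Plane → ℂ),
    TemperedDistribution.MemSobolev 2 2 (v : 𝓢'(Plane, ℂ)) ∧
    Continuous vc ∧ (v : Plane → ℂ) =ᵐ[volume] vc ∧
    (p.1 : Plane → ℂ) =ᵐ[volume] domainFunction α y z vc ∧
    ((p.2 - z ^ 2 • p.1 : L2Plane) : 𝓢'(Plane, ℂ))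
      = -Δ (v : 𝓢'(Plane, ℂ)) - z ^ 2 • (v : 𝓢'(Plane, ℂ))}
  zero_mem' := by
    refine ⟨0, fun _ => 0, ?_, continuous_const, Lp.coeFn_zero _ _ _, ?_, ?_⟩
    · rw [← Lp.toTemperedDistributionCLM_apply, map_zero]
      exact TemperedDistribution.memSobolev_fun_zero _ _ _ _
    · filter_upwards [Lp.coeFn_zero ℂ 2 (volume : Measure Plane)] with x hx
      simp [domainFunction, hx]
    · simp only [← Lp.toTemperedDistributionCLM_apply, Prod.fst_zero, Prod.snd_zero,
        smul_zero, sub_zero, map_zero, ← TemperedDistribution.laplacianCLM_apply, neg_zero]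
  add_mem' := by
    rintro ⟨u₁, f₁⟩ ⟨u₂, f₂⟩ ⟨v₁, w₁, hs₁, hc₁, hv₁, hu₁, he₁⟩ ⟨v₂, w₂, hs₂, hc₂, hv₂, hu₂, he₂⟩
    simp only at hu₁ he₁ hu₂ he₂
    refine ⟨v₁ + v₂, fun x => w₁ x + w₂ x, ?_, hc₁.add hc₂, ?_, ?_, ?_⟩
    · have := hs₁.add hs₂
      rwa [← Lp.toTemperedDistributionCLM_apply, ← Lp.toTemperedDistributionCLM_apply,
        ← map_add] at this
    · filter_upwards [Lp.coeFn_add v₁ v₂, hv₁, hv₂] with x h h₁ h₂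
      rw [h, Pi.add_apply, h₁, h₂]
    · filter_upwards [Lp.coeFn_add u₁ u₂, hu₁, hu₂] with x h h₁ h₂
      simp only [Prod.mk_add_mk, h, Pi.add_apply, h₁, h₂, domainFunction, mul_add, add_mul,
        Finset.sum_add_distrib]
      ring
    · have e : ((f₁, u₁) + (f₂, u₂) : L2Plane × L2Plane).1 - z ^ 2 • (u₁ + u₂)
          = (f₁ - z ^ 2 • u₁) + (f₂ - z ^ 2 • u₂) := by
        simp only [Prod.mk_add_mk, smul_add]; abel
      simp only [Prod.mk_add_mk] at e ⊢
      rw [e]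
      simp only [← Lp.toTemperedDistributionCLM_apply, ← TemperedDistribution.laplacianCLM_apply,
        map_add, smul_add] at he₁ he₂ ⊢
      rw [he₁, he₂]
      abel
  smul_mem' := by
    rintro c ⟨u, f⟩ ⟨v, w, hs, hc, hv, hu, he⟩
    simp only at hu he
    refine ⟨c • v, fun x => c * w x, ?_, continuous_const.mul hc, ?_, ?_, ?_⟩
    · have := hs.smul c
      rwa [← Lp.toTemperedDistributionCLM_apply, ← map_smul] at this
    · filter_upwards [Lp.coeFn_smul c v, hv] with x h h₁
      simp [h, h₁]
    · filter_upwards [Lp.coeFn_smul c u, hu] with x h h₁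
      simp only [Prod.smul_mk, h, Pi.smul_apply, h₁, domainFunction, smul_eq_mul, mul_add,
        Finset.mul_sum]
      congr 1
      refine Finset.sum_congr rfl fun j _ => Finset.sum_congr rfl fun k _ => ?_
      ring
    · have e : c • f - z ^ 2 • c • u = c • (f - z ^ 2 • u) := by
        rw [smul_sub, smul_comm]
      simp only [Prod.smul_mk]
      rw [e]
      simp only [← Lp.toTemperedDistributionCLM_apply, ← TemperedDistribution.laplacianCLM_apply,
        map_smul] at he ⊢
      rw [he, smul_sub, smul_neg, smul_comm]

/-- The self-adjoint operator `H_{α,Y}`, as an unbounded operator in `L²(ℝ²)`: for every `z` in the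
open upper half-plane with `Γ_{α,Y}(z)` invertible, its graph is the one described at `z`. (These
descriptions all give the same operator, so that the intersection is each of them.) -/
def pointInteraction (α : Fin N → ℝ) (y : Fin N → Plane) : L2Plane →ₗ.[ℂ] L2Plane :=
  (⨅ z ∈ admissible α y, pointInteractionGraphAt α y z).toLinearPMap

/-- The real symmetric matrix `𝒟̃`, with diagonal entries `α_j` and off-diagonal entries
`(2π)⁻¹ log |y_j - y_k|`. -/
def dMatrix (α : Fin N → ℝ) (y : Fin N → Plane) : Matrix (Fin N) (Fin N) ℝ :=
  Matrix.of fun j k => if j = k then α j else 1 / (2 * Real.pi) * Real.log ‖y j - y k‖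

/-- The function `-∑_j a_j (2π)⁻¹ log |x - y_j|`. -/
def logPotential (y : Fin N → Plane) (a : Fin N → ℂ) (x : Plane) : ℂ :=
  -∑ j, a j / (2 * (Real.pi : ℂ)) * ((Real.log ‖x - y j‖ : ℝ) : ℂ)

end

/-! Write `ψ = v + ∑ q_j 𝒢_z(· - y_j)` with `q = Γ(z)⁻¹ (v(y_k))_k`, and let `E(ξ) = ∑ q_j exp(-2πi
y_j·ξ)` (`expSum`). Since `𝒢_z` has Fourier transform `1/(4π²|ξ|² - z²)` (`fourier_greenKernel`),
the equation `-z²ψ = (-Δ - z²)v` amounts to `4π²|ξ|² ψ̂ = E`, in which `z` has disappeared: a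
zero-energy eigenfunction is a field of charges `q_j` at the `y_j`.

In the plane neither `|ξ|⁻²` nor `|ξ|⁻¹` is square integrable at the origin, so `ψ̂ ∈ L²` forces `E`
to vanish to second order there, which is the vanishing of `∑ q_j` and `∑ q_j y_j`
(`moments_eq_zero_of_memLp`). Conversely these conditions make `E/(4π²|ξ|²)` square integrable, and
it is the transform of the logarithmic potential, obtained as the limit of Green potentials at `z =
iκ`, `κ → 0` (`exists_fourier_logPotential`).

The matrix condition comes from the expansion of `K₀` at the origin (`tendsto_besselK_add_log`):
`-(2π)⁻¹ log|x| - 𝒢_z(x)` extends continuously, and its value at `0` is the diagonal entry of `Γ(z)`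
without `α_j`. Hence `v`, the potential minus the Green sum, takes at the points `y_k` the values
`Γ(z)q - 𝒟̃q` (`regularSum_apply_point`). As the domain requires `Γ(z)q = (v(y_k))_k`, it is
equivalent to `𝒟̃q = 0`.

Finally, a logarithmic potential with `q ≠ 0` is unbounded near some `y_k` and cannot agree almost
everywhere with a continuous function (`eq_zero_of_logPotential_ae_eq`). This gives `ψ ≠ 0`, the
single-valuedness of the graph, and the reality of the coefficients of a real `ψ`. -/

noncomputable section

open Filter Set Topology FourierTransform ContDiff

/-! ### Decay and continuity of `K₀` on the right half-plane -/

/-- The modified Bessel function `K₀` on the open right half-plane. -/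
def besselK (s : ℂ) : ℂ := ∫ t in Ioi (0 : ℝ), Complex.exp (-s * ((Real.cosh t : ℝ) : ℂ))

theorem greenKernel_eq_besselK (z : ℂ) (x : Plane) :
    greenKernel z x = 1 / (2 * (Real.pi : ℂ)) * besselK ((-Complex.I * z) * ((‖x‖ : ℝ) : ℂ)) := by
  have hpi : (Real.pi : ℂ) ≠ 0 := by exact_mod_cast Real.pi_ne_zero
  have h : ∀ t : ℝ, Complex.I * (z * ((‖x‖ : ℝ) : ℂ)) * ((Real.cosh t : ℝ) : ℂ)
      = -(-Complex.I * z * ((‖x‖ : ℝ) : ℂ)) * ((Real.cosh t : ℝ) : ℂ) := fun t => by ring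
  simp only [greenKernel, hankelZero, besselK, h]
  have hI := Complex.I_ne_zero
  field_simp
  ring

theorem exp_neg_le_inv_sqrt {x : ℝ} (hx : 0 < x) : Real.exp (-x) ≤ 1 / √x := by
  rw [Real.exp_neg, ← one_div]
  apply one_div_le_one_div_of_le (Real.sqrt_pos.2 hx)
  rw [Real.sqrt_le_left (Real.exp_pos x).le, ← Real.exp_nat_mul]
  have := Real.add_one_le_exp ((2 : ℕ) * x)
  push_cast at this ⊢
  linarith

theorem exp_div_two_le_cosh (t : ℝ) : Real.exp t / 2 ≤ Real.cosh t := by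
  rw [Real.cosh_eq]; linarith [Real.exp_pos (-t)]

/-- Half of `σ cosh t` is at least `σ/2` and keeps the decay in `σ`; the other half is at least `σ
eᵗ/4` and gives integrability in `t` at the cost of a factor `σ^(-1/2)`. This crude singularity is
still square integrable in the plane. -/
theorem exp_neg_mul_cosh_le {σ : ℝ} (hσ : 0 < σ) (t : ℝ) :
    Real.exp (-σ * Real.cosh t) ≤ 2 * Real.exp (-σ / 2) / √σ * Real.exp (-t / 2) := by
  have h1 : -σ * Real.cosh t ≤ -σ / 2 + -(σ * Real.exp t / 4) := by
    nlinarith [Real.one_le_cosh t, exp_div_two_le_cosh t]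
  have h2 : Real.exp (-(σ * Real.exp t / 4)) ≤ 2 / √σ * Real.exp (-t / 2) := by
    refine (exp_neg_le_inv_sqrt (by positivity)).trans (le_of_eq ?_)
    rw [show σ * Real.exp t / 4 = σ * (Real.exp (t / 2) / 2) ^ 2 by
      rw [div_pow, ← Real.exp_nat_mul]; push_cast; ring_nf]
    rw [Real.sqrt_mul hσ.le, Real.sqrt_sq (by positivity), neg_div, Real.exp_neg]
    field_simp
  calc Real.exp (-σ * Real.cosh t) ≤ Real.exp (-σ / 2 + -(σ * Real.exp t / 4)) :=
        Real.exp_le_exp.2 h1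
    _ = Real.exp (-σ / 2) * Real.exp (-(σ * Real.exp t / 4)) := Real.exp_add _ _
    _ ≤ Real.exp (-σ / 2) * (2 / √σ * Real.exp (-t / 2)) := by gcongr
    _ = _ := by ring

theorem norm_cexp_neg_mul_cosh (s : ℂ) (t : ℝ) :
    ‖Complex.exp (-s * ((Real.cosh t : ℝ) : ℂ))‖ = Real.exp (-s.re * Real.cosh t) := by
  rw [Complex.norm_exp]
  congr 1
  simp [-Complex.ofReal_cosh]

theorem integrableOn_exp_neg_div_two : IntegrableOn (fun t : ℝ => Real.exp (-t / 2)) (Ioi 0) := by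
  have := integrableOn_exp_mul_Ioi (a := -1 / 2) (by norm_num) 0
  refine this.congr_fun (fun t _ => ?_) measurableSet_Ioi
  simp only; ring_nf

theorem integral_exp_neg_div_two : ∫ t in Ioi (0 : ℝ), Real.exp (-t / 2) = 2 := by
  have := integral_exp_mul_Ioi (a := -1 / 2) (by norm_num) 0
  rw [show (fun t : ℝ => Real.exp (-t / 2)) = fun t => Real.exp (-1 / 2 * t) by
    funext t; ring_nf, this]
  norm_num

theorem continuous_cexp_neg_mul_cosh (s : ℂ) :
    Continuous fun t : ℝ => Complex.exp (-s * ((Real.cosh t : ℝ) : ℂ)) := by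
  have := Real.continuous_cosh
  fun_prop

theorem integrableOn_cexp_neg_mul_cosh {s : ℂ} (hs : 0 < s.re) :
    IntegrableOn (fun t : ℝ => Complex.exp (-s * ((Real.cosh t : ℝ) : ℂ))) (Ioi 0) := by
  refine (integrableOn_exp_neg_div_two.const_mul (2 * Real.exp (-s.re / 2) / √s.re)).mono'
    (continuous_cexp_neg_mul_cosh s).aestronglyMeasurable (ae_of_all _ fun t => ?_)
  rw [norm_cexp_neg_mul_cosh]
  exact exp_neg_mul_cosh_le hs t

theorem norm_besselK_le {s : ℂ} (hs : 0 < s.re) :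
    ‖besselK s‖ ≤ 4 * Real.exp (-s.re / 2) / √s.re := by
  refine (norm_integral_le_of_norm_le
    (integrableOn_exp_neg_div_two.const_mul (2 * Real.exp (-s.re / 2) / √s.re))
    (ae_of_all _ fun t => ?_)).trans (le_of_eq ?_)
  · rw [norm_cexp_neg_mul_cosh]
    exact exp_neg_mul_cosh_le hs t
  · rw [integral_const_mul, integral_exp_neg_div_two]; ring

theorem continuousAt_besselK {s : ℂ} (hs : 0 < s.re) : ContinuousAt besselK s := by
  refine continuousAt_of_dominated
    (bound := fun t => 2 / √(s.re / 2) * Real.exp (-t / 2)) ?_ ?_ ?_ ?_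
  · exact Eventually.of_forall fun w => (continuous_cexp_neg_mul_cosh w).aestronglyMeasurable
  · have : ∀ᶠ w : ℂ in 𝓝 s, s.re / 2 < w.re :=
      Complex.continuous_re.continuousAt.eventually (lt_mem_nhds (by linarith))
    filter_upwards [this] with w hw
    refine ae_of_all _ fun t => ?_
    rw [norm_cexp_neg_mul_cosh]
    have hw0 : 0 < w.re := by linarith
    refine (exp_neg_mul_cosh_le hw0 t).trans ?_
    gcongr
    have : Real.exp (-w.re / 2) ≤ 1 := Real.exp_le_one_iff.2 (by linarith)
    linarith
  · exact integrableOn_exp_neg_div_two.const_mul _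
  · refine ae_of_all _ fun t => ?_
    fun_prop

/-! ### Behaviour at the origin -/

/-- Differentiating a Mellin transform in `s` inserts a logarithm. The case `s = 1` evaluates the
logarithmic integral; `s = 2` supplies a dominating function below. -/
theorem mellinConvergent_log_mul_exp {η : ℂ} (hη : 0 < η.re) {s : ℂ} (hs : 0 < s.re) :
    MellinConvergent (fun u : ℝ => Real.log u • Complex.exp (-η * (u : ℂ))) s ∧
    HasDerivAt (mellin fun u : ℝ => Complex.exp (-η * (u : ℂ)))
      (mellin (fun u : ℝ => Real.log u • Complex.exp (-η * (u : ℂ))) s) s := by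
  have hfc : Continuous fun u : ℝ => Complex.exp (-η * u) := by fun_prop
  refine mellin_hasDerivAt_of_isBigO_rpow (a := s.re + 1) (b := 0)
    (hfc.locallyIntegrable.locallyIntegrableOn _) ?_ (by linarith) ?_ (by linarith)
  · have h1 := (isLittleO_exp_neg_mul_rpow_atTop hη (-(s.re + 1))).isBigO
    refine Asymptotics.IsBigO.trans (Asymptotics.isBigO_of_le _ fun u => ?_) h1
    simp [Complex.norm_exp]
  · simp only [neg_zero, Real.rpow_zero]
    exact (hfc.continuousAt.tendsto.mono_left nhdsWithin_le_nhds).isBigO_one ℝ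

theorem integrableOn_log_mul_exp {η : ℂ} (hη : 0 < η.re) :
    IntegrableOn (fun u : ℝ => ((Real.log u : ℝ) : ℂ) * Complex.exp (-η * u)) (Ioi 0) := by
  simpa [MellinConvergent] using (mellinConvergent_log_mul_exp hη (s := 1) (by norm_num)).1

theorem differentiableAt_integral_log_mul_exp {η : ℂ} (hη : 0 < η.re) :
    DifferentiableAt ℂ
      (fun w : ℂ => ∫ u in Ioi (0 : ℝ), ((Real.log u : ℝ) : ℂ) * Complex.exp (-w * u)) η := by
  have hlog : Measurable fun u : ℝ => ((Real.log u : ℝ) : ℂ) := by fun_prop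
  have h2 := (mellinConvergent_log_mul_exp (η := η / 2) (s := 2)
    (by rw [Complex.div_ofNat_re]; linarith) (by norm_num)).1
  refine (hasDerivAt_integral_of_dominated_loc_of_deriv_le
    (s := {w : ℂ | η.re / 2 < w.re})
    (F' := fun (w : ℂ) (u : ℝ) => ((Real.log u : ℝ) : ℂ) * (Complex.exp (-w * u) * (-(u : ℂ))))
    -- On `Re w > Re η / 2` one has `|exp(-wu)| ≤ |exp(-ηu/2)|`, and the factor `u` from the
    -- derivative makes this the Mellin integrand at `s = 2` for `η/2`.
    (bound := fun u : ℝ => ‖(u : ℂ) ^ ((2 : ℂ) - 1) • Real.log u • Complex.exp (-(η / 2) * u)‖)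
    ?_ ?_ ?_ ?_ ?_ h2.norm ?_).2.differentiableAt
  · exact Complex.continuous_re.continuousAt.eventually (lt_mem_nhds (by linarith))
  · exact Eventually.of_forall fun w =>
      (hlog.mul (by fun_prop : Measurable fun u : ℝ => Complex.exp (-w * u))).aestronglyMeasurable
  · exact integrableOn_log_mul_exp hη
  · exact (hlog.mul (by fun_prop : Measurable fun u : ℝ =>
      Complex.exp (-η * u) * (-(u : ℂ)))).aestronglyMeasurable
  · refine (ae_restrict_mem measurableSet_Ioi).mono fun u hu w hw => ?_
    have hu' : (0 : ℝ) < u := hu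
    have hw' : η.re / 2 < w.re := hw
    rw [show (2 : ℂ) - 1 = 1 by norm_num, Complex.cpow_one]
    simp only [norm_mul, norm_smul, Complex.norm_exp, norm_neg, Complex.norm_real]
    rw [mul_comm (Real.exp _), ← mul_assoc, ← mul_assoc, mul_comm ‖Real.log u‖]
    refine mul_le_mul_of_nonneg_left (Real.exp_le_exp.2 ?_) (by positivity)
    simp only [Complex.mul_re, Complex.neg_re, Complex.ofReal_re, Complex.ofReal_im, mul_zero,
      sub_zero, Complex.div_ofNat_re]
    nlinarith
  · refine ae_of_all _ fun u w _ => ?_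
    have := (((hasDerivAt_id w).neg.mul_const (u : ℂ)).cexp).const_mul ((Real.log u : ℝ) : ℂ)
    simpa using this

/-- The integral is the derivative at `s = 1` of `η^(-s) Γ(s)`, and `Γ'(1) = -γ`. -/
theorem mul_integral_log_mul_exp_ofReal {η : ℝ} (hη : 0 < η) :
    (η : ℂ) * ∫ u in Ioi (0 : ℝ), ((Real.log u : ℝ) : ℂ) * Complex.exp (-(η : ℂ) * u)
      = -Complex.log η - Real.eulerMascheroniConstant := by
  have hη0 : (η : ℂ) ≠ 0 := by exact_mod_cast hη.ne'
  have h2 := (mellinConvergent_log_mul_exp (η := η) (s := 1) (by simpa) (by norm_num)).2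
  have e2 : (mellin fun u : ℝ => Complex.exp (-(η : ℂ) * u))
      =ᶠ[𝓝 1] fun a => (1 / (η : ℂ)) ^ a * Complex.Gamma a := by
    have : ∀ᶠ a : ℂ in 𝓝 1, 0 < a.re :=
      Complex.continuous_re.continuousAt.eventually (lt_mem_nhds (by norm_num))
    filter_upwards [this] with a ha
    rw [← Complex.integral_cpow_mul_exp_neg_mul_Ioi ha hη]
    simp [mellin]
  have h3 : HasDerivAt (fun a : ℂ => (1 / (η : ℂ)) ^ a * Complex.Gamma a)
      ((1 / (η : ℂ)) ^ (1 : ℂ) * Complex.log (1 / η) * 1 * Complex.Gamma 1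
        + (1 / (η : ℂ)) ^ (1 : ℂ) * -Real.eulerMascheroniConstant) 1 :=
    ((hasDerivAt_id (1 : ℂ)).const_cpow (Or.inl (by simpa using hη.ne'))).mul
      Complex.hasDerivAt_Gamma_one
  have h4 := h2.unique (h3.congr_of_eventuallyEq e2)
  have h5 : mellin (fun t : ℝ => Real.log t • Complex.exp (-(η : ℂ) * t)) 1
      = ∫ u in Ioi (0 : ℝ), ((Real.log u : ℝ) : ℂ) * Complex.exp (-(η : ℂ) * u) := by
    simp [mellin]
  have hlog : Complex.log (1 / η) = -Complex.log η := by
    rw [one_div, Complex.log_inv]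
    rw [Complex.arg_ofReal_of_nonneg hη.le]
    exact Real.pi_pos.ne
  rw [← h5, h4, hlog]
  simp only [Complex.cpow_one, Complex.Gamma_one]
  field_simp
  ring

/-- Both sides are holomorphic on the half-plane and agree at the reals to the right of `1`, which
accumulate at `1`. -/
theorem mul_integral_log_mul_exp {η : ℂ} (hη : 0 < η.re) :
    η * ∫ u in Ioi (0 : ℝ), ((Real.log u : ℝ) : ℂ) * Complex.exp (-η * u)
      = -Complex.log η - Real.eulerMascheroniConstant := by
  have hopen : IsOpen {w : ℂ | 0 < w.re} := isOpen_lt continuous_const Complex.continuous_re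
  have hl : AnalyticOnNhd ℂ (fun w : ℂ =>
      w * ∫ u in Ioi (0 : ℝ), ((Real.log u : ℝ) : ℂ) * Complex.exp (-w * u)) {w | 0 < w.re} :=
    DifferentiableOn.analyticOnNhd (fun w hw => (differentiableAt_id.mul
      (differentiableAt_integral_log_mul_exp hw)).differentiableWithinAt) hopen
  have hr : AnalyticOnNhd ℂ (fun w : ℂ => -Complex.log w - Real.eulerMascheroniConstant)
      {w | 0 < w.re} :=
    DifferentiableOn.analyticOnNhd (fun w hw => ((Complex.differentiableAt_log
      (Or.inl hw)).neg.sub_const _).differentiableWithinAt) hopen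
  have hconn : IsPreconnected {w : ℂ | 0 < w.re} := (convex_halfSpace_re_gt 0).isPreconnected
  refine hl.eqOn_of_preconnected_of_frequently_eq hr hconn (z₀ := 1) (by simp) ?_ hη
  have ht : Tendsto (fun x : ℝ => (x : ℂ)) (𝓝[>] 1) (𝓝[≠] 1) := by
    refine tendsto_nhdsWithin_iff.2 ⟨?_, ?_⟩
    · exact (Complex.continuous_ofReal.tendsto' 1 1 (by simp)).mono_left nhdsWithin_le_nhds
    · filter_upwards [self_mem_nhdsWithin] with x hx
      have : (1 : ℝ) < x := hx
      simpa using this.ne'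
  refine ht.frequently (Eventually.frequently ?_)
  filter_upwards [self_mem_nhdsWithin] with x hx
  exact mul_integral_log_mul_exp_ofReal (lt_trans one_pos hx)

theorem mul_exp_image_Ioi {r : ℝ} (hr : 0 < r) :
    (fun t : ℝ => r * Real.exp t) '' Ioi 0 = Ioi r := by
  ext u
  simp only [mem_image, mem_Ioi]
  constructor
  · rintro ⟨t, ht, rfl⟩
    nlinarith [Real.add_one_lt_exp ht.ne']
  · intro hu
    have h1 : 1 < u / r := (one_lt_div hr).2 hu
    refine ⟨Real.log (u / r), Real.log_pos h1, ?_⟩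
    rw [Real.exp_log (by linarith)]
    field_simp

theorem mul_exp_image_univ {r : ℝ} (hr : 0 < r) :
    (fun t : ℝ => r * Real.exp t) '' univ = Ioi 0 := by
  ext u
  simp only [mem_image, mem_univ, true_and, mem_Ioi]
  constructor
  · rintro ⟨t, rfl⟩
    positivity
  · intro hu
    refine ⟨Real.log (u / r), ?_⟩
    rw [Real.exp_log (by positivity)]
    field_simp

theorem hasDerivAt_mul_exp (r t : ℝ) :
    HasDerivAt (fun t : ℝ => r * Real.exp t) (r * Real.exp t) t :=
  (Real.hasDerivAt_exp t).const_mul r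

theorem injective_mul_exp {r : ℝ} (hr : 0 < r) :
    Function.Injective fun t : ℝ => r * Real.exp t := fun _ _ h =>
  Real.exp_injective (mul_left_cancel₀ hr.ne' h)

/-- With `u = r eᵗ` the left side is `∫_r^∞ exp(-ηu) du/u`. Integration by parts is done in `t`,
against `log(r eᵗ)`, whose derivative is `1`. -/
theorem integral_exp_neg_mul_exp {η : ℂ} (hη : 0 < η.re) {r : ℝ} (hr : 0 < r) :
    ∫ t in Ioi (0 : ℝ), Complex.exp (-η * ((r * Real.exp t : ℝ) : ℂ)) =
      -(Real.log r : ℂ) * Complex.exp (-η * r)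
        + η * ∫ u in Ioi r, ((Real.log u : ℝ) : ℂ) * Complex.exp (-η * u) := by
  set f : ℝ → ℝ := fun t => r * Real.exp t with hf
  have hfpos : ∀ t, 0 < f t := fun t => by simp only [hf]; positivity
  have habs : ∀ t, |f t| = f t := fun t => abs_of_pos (hfpos t)
  have hlogf : ∀ t, Real.log (f t) = Real.log r + t := fun t => by
    rw [hf, Real.log_mul hr.ne' (Real.exp_pos t).ne', Real.log_exp]
  have hd : ∀ t ∈ Ioi (0 : ℝ), HasDerivWithinAt f (f t) (Ioi 0) t :=
    fun t _ => (hasDerivAt_mul_exp r t).hasDerivWithinAt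
  have hinj : InjOn f (Ioi 0) := (injective_mul_exp hr).injOn
  have hint := (integrableOn_log_mul_exp hη).mono_set (Ioi_subset_Ioi hr.le)
  have e1 := integral_image_eq_integral_abs_deriv_smul measurableSet_Ioi hd hinj
    (fun u : ℝ => ((Real.log u : ℝ) : ℂ) * Complex.exp (-η * u))
  have e2 := (integrableOn_image_iff_integrableOn_abs_deriv_smul measurableSet_Ioi hd hinj
    (fun u : ℝ => ((Real.log u : ℝ) : ℂ) * Complex.exp (-η * u)))
  rw [mul_exp_image_Ioi hr] at e1 e2
  have hint2 := e2.1 hint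
  simp only [habs] at e1 hint2
  have hv : ∀ t : ℝ, HasDerivAt (fun t => Complex.exp (-η * (f t : ℂ)))
      (Complex.exp (-η * (f t : ℂ)) * (-η * (f t : ℂ))) t := fun t =>
    ((hasDerivAt_mul_exp r t).ofReal_comp.const_mul (-η)).cexp
  have hu : ∀ t : ℝ, HasDerivAt (fun t => ((Real.log (f t) : ℝ) : ℂ)) 1 t := fun t => by
    simp only [hlogf]
    have := ((hasDerivAt_id t).const_add (Real.log r)).ofReal_comp
    simpa using this
  have hvint : IntegrableOn (fun t => Complex.exp (-η * (f t : ℂ))) (Ioi 0) := by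
    have h1 := integrableOn_exp_mul_Ioi (a := -(η.re * r)) (by nlinarith) 0
    refine h1.mono' ?_ (ae_of_all _ fun t => ?_)
    · have : Continuous f := by fun_prop
      exact (by fun_prop : Continuous fun t => Complex.exp (-η * (f t : ℂ))).aestronglyMeasurable
    · rw [Complex.norm_exp]
      apply Real.exp_le_exp.2
      simp only [Complex.mul_re, Complex.neg_re, Complex.ofReal_re, Complex.ofReal_im, mul_zero,
        sub_zero, hf]
      have := Real.add_one_le_exp t
      have h3 : 0 < η.re * r := mul_pos hη hr
      nlinarith
  have hlim : Tendsto (fun u : ℝ => ((Real.log u : ℝ) : ℂ) * Complex.exp (-η * u)) atTop (𝓝 0) := by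
    rw [tendsto_zero_iff_norm_tendsto_zero]
    have h1 := (isLittleO_exp_neg_mul_rpow_atTop hη (-1)).isBigO
    have h2 : (fun u : ℝ => Real.log u) =o[atTop] fun u => u ^ (1 : ℝ) :=
      isLittleO_log_rpow_atTop one_pos
    have h3 := (h2.mul_isBigO h1).congr' (EventuallyEq.refl _ _)
      (g₂ := fun _ => (1 : ℝ)) ?_
    · have h4 := ((Asymptotics.isLittleO_one_iff ℝ).1 h3).norm
      rw [norm_zero] at h4
      refine h4.congr fun u => ?_
      simp [Complex.norm_exp]
    · filter_upwards [eventually_gt_atTop 0] with u hu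
      rw [← Real.rpow_add hu]; simp
  have hparts := integral_Ioi_mul_deriv_eq_deriv_mul (a := 0)
    (u := fun t => ((Real.log (f t) : ℝ) : ℂ)) (v := fun t => Complex.exp (-η * (f t : ℂ)))
    (u' := fun _ => 1) (v' := fun t => Complex.exp (-η * (f t : ℂ)) * (-η * (f t : ℂ)))
    (a' := (Real.log r : ℂ) * Complex.exp (-η * r)) (b' := 0)
    (fun t _ => hu t) (fun t _ => hv t) ?_ ?_ ?_ ?_
  · have e3 : ∫ t in Ioi (0 : ℝ), ((Real.log (f t) : ℝ) : ℂ)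
        * (Complex.exp (-η * (f t : ℂ)) * (-η * (f t : ℂ)))
        = -η * ∫ u in Ioi r, ((Real.log u : ℝ) : ℂ) * Complex.exp (-η * u) := by
      rw [e1, ← integral_const_mul]
      refine integral_congr_ae (ae_of_all _ fun t => ?_)
      simp only [Complex.real_smul]
      ring
    rw [e3] at hparts
    simp only [one_mul] at hparts
    linear_combination hparts
  · refine (hint2.const_mul (-η)).congr (ae_of_all _ fun t => ?_)
    simp only [Complex.real_smul, Pi.mul_apply]
    ring
  · refine hvint.congr (ae_of_all _ fun t => ?_)
    simp
  · have : ContinuousAt (fun t => ((Real.log (f t) : ℝ) : ℂ) * Complex.exp (-η * (f t : ℂ))) 0 :=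
      (hu 0).continuousAt.mul (hv 0).continuousAt
    have := this.tendsto.mono_left (nhdsWithin_le_nhds (s := Ioi 0))
    simp only [hf, Real.exp_zero, mul_one] at this
    exact this
  · have : Tendsto f atTop atTop := Real.tendsto_exp_atTop.const_mul_atTop hr
    exact hlim.comp this

theorem tendsto_integral_exp_neg_mul_exp_add_log {η : ℂ} (hη : 0 < η.re) :
    Tendsto (fun r : ℝ => (∫ t in Ioi (0 : ℝ), Complex.exp (-η * ((r * Real.exp t : ℝ) : ℂ)))
      + (Real.log r : ℂ)) (𝓝[>] 0)
      (𝓝 (-Complex.log η - Real.eulerMascheroniConstant)) := by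
  have h1 : Tendsto (fun r : ℝ =>
      ∫ u in Ioi r, ((Real.log u : ℝ) : ℂ) * Complex.exp (-η * u)) (𝓝[>] 0)
      (𝓝 (∫ u in Ioi (0 : ℝ), ((Real.log u : ℝ) : ℂ) * Complex.exp (-η * u))) := by
    have hid : Tendsto (fun r : ℝ => r) (𝓝[>] 0) (𝓝 0) := nhdsWithin_le_nhds
    have := (aecover_Ioi_of_Ioi (μ := volume) hid).integral_tendsto_of_countably_generated
      (integrableOn_log_mul_exp hη)
    refine this.congr' ?_
    filter_upwards [self_mem_nhdsWithin] with r hr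
    rw [Measure.restrict_restrict measurableSet_Ioi, inter_eq_left.2 (Ioi_subset_Ioi (le_of_lt hr))]
  have h2 : Tendsto (fun r : ℝ => (Real.log r : ℂ) * (1 - Complex.exp (-η * r)))
      (𝓝[>] 0) (𝓝 0) := by
    have hlog := tendsto_log_mul_rpow_nhdsGT_zero one_pos
    simp only [Real.rpow_one] at hlog
    have hb := (hlog.norm.const_mul (2 * ‖η‖))
    rw [norm_zero, mul_zero] at hb
    refine squeeze_zero_norm' ?_ hb
    have hsmall : ∀ᶠ r : ℝ in 𝓝[>] 0, ‖-η * (r : ℂ)‖ < 1 := by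
      have : ContinuousAt (fun r : ℝ => ‖-η * (r : ℂ)‖) 0 := by fun_prop
      refine (this.tendsto.mono_left nhdsWithin_le_nhds).eventually (gt_mem_nhds ?_)
      simp
    filter_upwards [hsmall] with r hr
    have := Complex.norm_exp_sub_one_le hr.le
    rw [norm_mul, norm_sub_rev, Complex.norm_real, norm_mul]
    rw [norm_mul, norm_neg, Complex.norm_real] at this
    calc ‖Real.log r‖ * ‖Complex.exp (-η * r) - 1‖ ≤ ‖Real.log r‖ * (2 * (‖η‖ * ‖r‖)) := by gcongr
      _ = _ := by ring
  have h3 := h2.add (h1.const_mul η)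
  rw [mul_integral_log_mul_exp hη, zero_add] at h3
  refine h3.congr' ?_
  filter_upwards [self_mem_nhdsWithin] with r hr
  rw [integral_exp_neg_mul_exp hη hr]
  ring

/-- Replacing `cosh t` by `eᵗ/2` changes the exponent by `-η r e^(-t)`, hence the integral by
`O(r)`; the simplified integral has the explicit expansion just obtained. -/
theorem tendsto_besselK_add_log {ζ : ℂ} (hζ : 0 < ζ.re) :
    Tendsto (fun r : ℝ => besselK (ζ * r) + (Real.log r : ℂ)) (𝓝[>] 0)
      (𝓝 (-Complex.log (ζ / 2) - Real.eulerMascheroniConstant)) := by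
  set η := ζ / 2 with hηdef
  have hη : 0 < η.re := by rw [hηdef, Complex.div_ofNat_re]; linarith
  have hdiff : Tendsto (fun r : ℝ => besselK (ζ * r)
      - ∫ t in Ioi (0 : ℝ), Complex.exp (-η * ((r * Real.exp t : ℝ) : ℂ))) (𝓝[>] 0) (𝓝 0) := by
    have hb : Tendsto (fun r : ℝ => 2 * ‖-η * (r : ℂ)‖ * 2) (𝓝[>] 0) (𝓝 0) := by
      have : Continuous (fun r : ℝ => 2 * ‖-η * (r : ℂ)‖ * 2) := by fun_prop
      exact (this.tendsto' 0 0 (by simp)).mono_left nhdsWithin_le_nhds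
    have hsmall : ∀ᶠ r : ℝ in 𝓝[>] 0, ‖-η * (r : ℂ)‖ < 1 := by
      have : ContinuousAt (fun r : ℝ => ‖-η * (r : ℂ)‖) 0 := by fun_prop
      refine (this.tendsto.mono_left nhdsWithin_le_nhds).eventually (gt_mem_nhds ?_)
      simp
    refine squeeze_zero_norm' ?_ hb
    filter_upwards [hsmall, self_mem_nhdsWithin] with r hr hr0
    have hr0' : (0 : ℝ) < r := hr0
    have hpt : ∀ t ∈ Ioi (0 : ℝ), ‖Complex.exp (-(ζ * r) * ((Real.cosh t : ℝ) : ℂ))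
        - Complex.exp (-η * ((r * Real.exp t : ℝ) : ℂ))‖
        ≤ 2 * ‖-η * (r : ℂ)‖ * Real.exp (-t / 2) := by
      intro t ht
      have ht' : (0 : ℝ) < t := ht
      have hle : Real.exp (-t) ≤ 1 := Real.exp_le_one_iff.2 (by linarith)
      have e : -(ζ * r) * ((Real.cosh t : ℝ) : ℂ)
          = -η * ((r * Real.exp t : ℝ) : ℂ) + -η * (r : ℂ) * ((Real.exp (-t) : ℝ) : ℂ) := by
        rw [Real.cosh_eq, hηdef]; push_cast; ring
      rw [e, Complex.exp_add, ← mul_sub_one, norm_mul]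
      have hn : ‖-η * (r : ℂ) * ((Real.exp (-t) : ℝ) : ℂ)‖ = ‖-η * (r : ℂ)‖ * Real.exp (-t) := by
        rw [norm_mul _ ((Real.exp (-t) : ℝ) : ℂ), Complex.norm_real, Real.norm_of_nonneg
          (Real.exp_pos _).le]
      have h1 : ‖Complex.exp (-η * ((r * Real.exp t : ℝ) : ℂ))‖ ≤ 1 := by
        rw [Complex.norm_exp, Real.exp_le_one_iff]
        simp only [Complex.mul_re, Complex.neg_re, Complex.ofReal_re, Complex.ofReal_im, mul_zero,
          sub_zero]
        have : 0 < η.re * (r * Real.exp t) := by positivity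
        linarith
      have h2 := Complex.norm_exp_sub_one_le (x := -η * (r : ℂ) * ((Real.exp (-t) : ℝ) : ℂ)) (by
        rw [hn]; exact mul_le_one₀ hr.le (Real.exp_pos _).le hle)
      rw [hn] at h2
      have h3 : Real.exp (-t) ≤ Real.exp (-t / 2) := Real.exp_le_exp.2 (by linarith)
      calc _ ≤ 1 * (2 * (‖-η * (r : ℂ)‖ * Real.exp (-t))) := by gcongr
        _ ≤ 1 * (2 * (‖-η * (r : ℂ)‖ * Real.exp (-t / 2))) := by gcongr
        _ = _ := by ring
    have hre : 0 < (ζ * r).re := by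
      simp only [Complex.mul_re, Complex.ofReal_re, Complex.ofReal_im, mul_zero, sub_zero]
      positivity
    have hbint := integrableOn_exp_neg_div_two.const_mul (2 * ‖-η * (r : ℂ)‖)
    have hi1 := integrableOn_cexp_neg_mul_cosh hre
    have hmeas : Continuous fun t : ℝ => Complex.exp (-η * ((r * Real.exp t : ℝ) : ℂ)) := by
      fun_prop
    have hd : IntegrableOn (fun t : ℝ => Complex.exp (-(ζ * r) * ((Real.cosh t : ℝ) : ℂ))
        - Complex.exp (-η * ((r * Real.exp t : ℝ) : ℂ))) (Ioi 0) :=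
      hbint.mono' ((continuous_cexp_neg_mul_cosh _).sub hmeas).aestronglyMeasurable
        ((ae_restrict_mem measurableSet_Ioi).mono hpt)
    have hi2 : IntegrableOn (fun t : ℝ => Complex.exp (-η * ((r * Real.exp t : ℝ) : ℂ)))
        (Ioi 0) := by
      refine (hi1.sub hd).congr (ae_of_all _ fun t => ?_)
      simp
    rw [besselK, ← integral_sub hi1 hi2]
    refine (norm_integral_le_of_norm_le hbint
      ((ae_restrict_mem measurableSet_Ioi).mono hpt)).trans (le_of_eq ?_)
    rw [integral_const_mul, integral_exp_neg_div_two]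
  have := hdiff.add (tendsto_integral_exp_neg_mul_exp_add_log hη)
  rw [zero_add] at this
  refine this.congr fun r => ?_
  ring

/-! ### Representation by the heat kernel -/

/-- Substitute `τ = (r/2) eᵗ`: then `ζτ + ζr²/(4τ) = ζ r cosh t` and `dτ/τ = dt`. The integral over
the whole line is twice `K₀` by evenness. -/
theorem besselK_eq_heat {ζ : ℂ} (hζ : 0 < ζ.re) {r : ℝ} (hr : 0 < r) :
    besselK (ζ * r) = 1 / 2 * ∫ τ in Ioi (0 : ℝ),
      Complex.exp (-ζ * τ) * Complex.exp (-(ζ / (4 * τ)) * (r : ℂ) ^ 2) / (τ : ℂ) := by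
  have hre : 0 < (ζ * r).re := by
    simp only [Complex.mul_re, Complex.ofReal_re, Complex.ofReal_im, mul_zero, sub_zero]
    positivity
  have hr2 : 0 < r / 2 := by positivity
  set F : ℝ → ℂ := fun t => Complex.exp (-(ζ * r) * ((Real.cosh t : ℝ) : ℂ)) with hF
  have hFneg : ∀ t, F (-t) = F t := fun t => by simp only [hF, Real.cosh_neg]
  have hFi : IntegrableOn F (Ioi 0) := integrableOn_cexp_neg_mul_cosh hre
  have hFi' : IntegrableOn F (Iic 0) := by
    refine ((integrableOn_exp_mul_Iic (a := 1 / 2) (by norm_num) 0).const_mul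
      (2 * Real.exp (-(ζ * r).re / 2) / √(ζ * r).re)).mono'
      (continuous_cexp_neg_mul_cosh _).aestronglyMeasurable (ae_of_all _ fun t => ?_)
    have := exp_neg_mul_cosh_le hre (-t)
    rw [Real.cosh_neg, neg_neg, ← norm_cexp_neg_mul_cosh] at this
    refine this.trans (le_of_eq ?_)
    ring_nf
  have h1 : ∫ t, F t = 2 * besselK (ζ * r) := by
    rw [← intervalIntegral.integral_Iic_add_Ioi hFi' hFi]
    have : ∫ t in Iic (0 : ℝ), F t = ∫ t in Ioi (0 : ℝ), F t := by
      have := integral_comp_neg_Ioi 0 F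
      simp only [hFneg, neg_zero] at this
      exact this.symm
    rw [this]
    simp only [besselK, hF]
    ring
  have e1 := integral_image_eq_integral_abs_deriv_smul MeasurableSet.univ
    (fun t _ => (hasDerivAt_mul_exp (r / 2) t).hasDerivWithinAt) (injective_mul_exp hr2).injOn
    (fun τ : ℝ => Complex.exp (-ζ * τ) * Complex.exp (-(ζ / (4 * τ)) * (r : ℂ) ^ 2) / (τ : ℂ))
  rw [mul_exp_image_univ hr2, setIntegral_univ] at e1
  rw [e1]
  have e2 : ∀ t : ℝ, |r / 2 * Real.exp t| • (Complex.exp (-ζ * ((r / 2 * Real.exp t : ℝ) : ℂ))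
      * Complex.exp (-(ζ / (4 * ((r / 2 * Real.exp t : ℝ) : ℂ))) * (r : ℂ) ^ 2)
        / ((r / 2 * Real.exp t : ℝ) : ℂ)) = F t := by
    intro t
    have hpos : 0 < r / 2 * Real.exp t := by positivity
    have hne : ((r / 2 * Real.exp t : ℝ) : ℂ) ≠ 0 := by exact_mod_cast hpos.ne'
    rw [abs_of_pos hpos, Complex.real_smul, mul_div_cancel₀ _ hne, ← Complex.exp_add, hF]
    congr 1
    have hrc : (r : ℂ) ≠ 0 := by exact_mod_cast hr.ne'
    have het : ((Real.exp t : ℝ) : ℂ) ≠ 0 := by exact_mod_cast (Real.exp_pos t).ne'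
    rw [Real.cosh_eq, Real.exp_neg]
    push_cast at het ⊢
    field_simp
    ring
  simp only [e2]
  rw [h1]
  ring

/-! ### Size, continuity and integrability of the Green kernel -/

theorem re_neg_I_mul (z : ℂ) : (-Complex.I * z).re = z.im := by simp

theorem neg_I_mul_sq (z : ℂ) : (-Complex.I * z) ^ 2 = -z ^ 2 := by
  rw [mul_pow, neg_sq, Complex.I_sq]; ring

theorem mul_ofReal_re_pos {ζ : ℂ} (hζ : 0 < ζ.re) {r : ℝ} (hr : 0 < r) : 0 < (ζ * (r : ℂ)).re := by
  simp only [Complex.mul_re, Complex.ofReal_re, Complex.ofReal_im, mul_zero, sub_zero]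
  positivity

theorem continuousAt_greenKernel {z : ℂ} (hz : 0 < z.im) {x : Plane} (hx : x ≠ 0) :
    ContinuousAt (greenKernel z) x := by
  have h : 0 < (-Complex.I * z * ((‖x‖ : ℝ) : ℂ)).re :=
    mul_ofReal_re_pos (by rwa [re_neg_I_mul]) (norm_pos_iff.2 hx)
  have hc : ContinuousAt (fun x : Plane => -Complex.I * z * ((‖x‖ : ℝ) : ℂ)) x := by fun_prop
  have := (ContinuousAt.comp (f := fun x : Plane => -Complex.I * z * ((‖x‖ : ℝ) : ℂ))
    (continuousAt_besselK h) hc).const_mul (1 / (2 * (Real.pi : ℂ)))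
  exact this.congr (Eventually.of_forall fun x => (greenKernel_eq_besselK z x).symm)

theorem aestronglyMeasurable_greenKernel {z : ℂ} (hz : 0 < z.im) :
    AEStronglyMeasurable (greenKernel z) (volume : Measure Plane) := by
  rw [← restrict_compl_singleton (μ := (volume : Measure Plane)) 0]
  exact ContinuousOn.aestronglyMeasurable
    (fun x hx => (continuousAt_greenKernel hz hx).continuousWithinAt)
    (measurableSet_singleton _).compl

theorem norm_greenKernel_le {z : ℂ} (hz : 0 < z.im) {x : Plane} (hx : x ≠ 0) :
    ‖greenKernel z x‖ ≤ Real.exp (-(z.im * ‖x‖) / 2) / √(z.im * ‖x‖) := by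
  have h : (-Complex.I * z * ((‖x‖ : ℝ) : ℂ)).re = z.im * ‖x‖ := by
    rw [Complex.mul_re, re_neg_I_mul]; simp
  have hpos : 0 < z.im * ‖x‖ := mul_pos hz (norm_pos_iff.2 hx)
  have hb := norm_besselK_le (s := -Complex.I * z * ((‖x‖ : ℝ) : ℂ)) (by rwa [h])
  rw [h] at hb
  rw [greenKernel_eq_besselK, norm_mul]
  have hc : ‖1 / (2 * (Real.pi : ℂ))‖ ≤ 1 / 4 := by
    rw [norm_div, norm_mul, Complex.norm_real, Real.norm_of_nonneg Real.pi_pos.le]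
    simp only [norm_one, Complex.norm_ofNat]
    apply one_div_le_one_div_of_le (by norm_num)
    linarith [Real.two_le_pi]
  calc _ ≤ 1 / 4 * (4 * Real.exp (-(z.im * ‖x‖) / 2) / √(z.im * ‖x‖)) := by gcongr
    _ = _ := by ring

theorem ae_ne_zero_plane : ∀ᵐ x : Plane, x ≠ 0 := by
  simp [ae_iff]

theorem finrank_plane : Module.finrank ℝ Plane = 2 := by simp

theorem integrable_radial {f : ℝ → ℝ} :
    Integrable (fun x : Plane => f ‖x‖) ↔ IntegrableOn (fun r : ℝ => r * f r) (Ioi 0) := by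
  have := integrable_fun_norm_addHaar (volume : Measure Plane) (f := f)
  rw [finrank_plane] at this
  simpa using this

theorem integrable_greenKernel {z : ℂ} (hz : 0 < z.im) :
    Integrable (greenKernel z) (volume : Measure Plane) := by
  have h : Integrable (fun x : Plane =>
      (fun r : ℝ => Real.exp (-(z.im * r) / 2) / √(z.im * r)) ‖x‖) volume := by
    refine (integrable_radial (f := fun r => Real.exp (-(z.im * r) / 2) / √(z.im * r))).2 ?_
    have h1 := (integrableOn_exp_mul_Ioi (a := -z.im / 4) (by linarith) 0).const_mul (2 / z.im)
    refine h1.mono' (by fun_prop) ((ae_restrict_mem measurableSet_Ioi).mono fun r hr => ?_)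
    have hr' : (0 : ℝ) < r := hr
    have hx : 0 < z.im * r := mul_pos hz hr'
    -- The polar weight `r` leaves a factor of order `√(z.im * r)`; half of the exponential decay
    -- absorbs it and the other half is integrated.
    have h2 := exp_neg_le_inv_sqrt (x := z.im * r / 4) (by positivity)
    have h3 : √(z.im * r / 4) = √(z.im * r) / 2 := by
      rw [show z.im * r / 4 = z.im * r * (1 / 2) ^ 2 by ring, Real.sqrt_mul hx.le,
        Real.sqrt_sq (by norm_num)]
      ring
    rw [h3, le_div_iff₀ (by positivity)] at h2
    have hs : 0 < √(z.im * r) := Real.sqrt_pos.2 hx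
    rw [Real.norm_of_nonneg (by positivity)]
    have e1 : r * (Real.exp (-(z.im * r) / 2) / √(z.im * r))
        = 2 / z.im * Real.exp (-z.im / 4 * r)
          * (Real.exp (-(z.im * r / 4)) * (√(z.im * r) / 2)) := by
      rw [show -(z.im * r) / 2 = -z.im / 4 * r + -(z.im * r / 4) by ring, Real.exp_add]
      field_simp
      rw [Real.sq_sqrt (by positivity)]
    rw [e1]
    exact mul_le_of_le_one_right (by positivity) h2
  refine h.mono' (aestronglyMeasurable_greenKernel hz) ?_
  filter_upwards [ae_ne_zero_plane] with x hx
  exact norm_greenKernel_le hz hx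

theorem memLp_two_greenKernel {z : ℂ} (hz : 0 < z.im) :
    MemLp (greenKernel z) 2 (volume : Measure Plane) := by
  rw [memLp_two_iff_integrable_sq_norm (aestronglyMeasurable_greenKernel hz)]
  have h : Integrable (fun x : Plane =>
      (fun r : ℝ => (Real.exp (-(z.im * r) / 2) / √(z.im * r)) ^ 2) ‖x‖) volume := by
    refine (integrable_radial
      (f := fun r => (Real.exp (-(z.im * r) / 2) / √(z.im * r)) ^ 2)).2 ?_
    have h1 := (integrableOn_exp_mul_Ioi (a := -z.im) (by linarith) 0).const_mul (1 / z.im)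
    refine h1.congr ((ae_restrict_mem measurableSet_Ioi).mono fun r hr => ?_)
    have hr' : (0 : ℝ) < r := hr
    have hx : 0 < z.im * r := mul_pos hz hr'
    simp only
    rw [div_pow, Real.sq_sqrt hx.le, ← Real.exp_nat_mul]
    push_cast
    rw [show (2 : ℝ) * (-(z.im * r) / 2) = -z.im * r by ring]
    field_simp
  refine h.mono' ((aestronglyMeasurable_greenKernel hz).norm.pow 2) ?_
  filter_upwards [ae_ne_zero_plane] with x hx
  rw [Real.norm_of_nonneg (by positivity)]
  have := norm_greenKernel_le hz hx
  gcongr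

/-! ### The Fourier transform of the Green kernel -/

/-- The symbol `4π²|ξ|² - z²` of `-Δ - z²`. -/
def symb (z : ℂ) (ξ : Plane) : ℂ := 4 * (Real.pi : ℂ) ^ 2 * ((‖ξ‖ : ℝ) : ℂ) ^ 2 - z ^ 2

theorem re_add_div_pos {ζ : ℂ} (hζ : 0 < ζ.re) {A : ℝ} (hA : 0 ≤ A) : 0 < (ζ + A / ζ).re := by
  have h : 0 ≤ ((A : ℂ) / ζ).re := by
    rw [div_eq_mul_inv, Complex.re_ofReal_mul, Complex.inv_re]
    have := Complex.normSq_nonneg ζ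
    positivity
  rw [Complex.add_re]; linarith

/-- For `ζ = -iz` both factors have positive real part, so the symbol never vanishes; the second
factor is the decay rate left by the Gaussian transform in `fourier_greenKernel`. -/
theorem symb_eq {z : ℂ} (hz : 0 < z.im) (ξ : Plane) :
    symb z ξ = (-Complex.I * z)
      * (-Complex.I * z + ((4 * Real.pi ^ 2 * ‖ξ‖ ^ 2 : ℝ) : ℂ) / (-Complex.I * z)) := by
  have h : -Complex.I * z ≠ 0 := fun h => by
    have := re_neg_I_mul z; rw [h] at this; simp at this; linarith
  rw [mul_add, mul_div_cancel₀ _ h, ← sq, neg_I_mul_sq, symb]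
  push_cast; ring

theorem symb_ne_zero {z : ℂ} (hz : 0 < z.im) (ξ : Plane) : symb z ξ ≠ 0 := by
  rw [symb_eq hz]
  have h : 0 < (-Complex.I * z).re := by rwa [re_neg_I_mul]
  have h1 := re_add_div_pos h (A := 4 * Real.pi ^ 2 * ‖ξ‖ ^ 2) (by positivity)
  refine mul_ne_zero (fun e => ?_) (fun e => ?_)
  · rw [e] at h; simp at h
  · rw [e] at h1; simp at h1

/-- The integrand in the representation of the Fourier transform of the Green kernel by that of
heat kernels at complex times. -/
def heatIntegrand (ζ : ℂ) (ξ x : Plane) (τ : ℝ) : ℂ :=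
  Real.fourierChar (-inner ℝ x ξ) •
    (Complex.exp (-ζ * τ) * Complex.exp (-(ζ / (4 * τ)) * ((‖x‖ : ℝ) : ℂ) ^ 2) / (τ : ℂ))

theorem norm_heatIntegrand (ζ : ℂ) (ξ x : Plane) {τ : ℝ} (hτ : 0 < τ) :
    ‖heatIntegrand ζ ξ x τ‖
      = Real.exp (-ζ.re * τ) / τ * Real.exp (-(ζ.re / (4 * τ)) * ‖x‖ ^ 2) := by
  rw [heatIntegrand, Circle.norm_smul, norm_div, norm_mul, Complex.norm_exp, Complex.norm_exp,
    Complex.norm_real, Real.norm_of_nonneg hτ.le]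
  have e1 : (-ζ * (τ : ℂ)).re = -ζ.re * τ := by simp
  have e2 : (-(ζ / (4 * (τ : ℂ))) * ((‖x‖ : ℝ) : ℂ) ^ 2).re = -(ζ.re / (4 * τ)) * ‖x‖ ^ 2 := by
    have : -(ζ / (4 * (τ : ℂ))) * ((‖x‖ : ℝ) : ℂ) ^ 2
        = ζ * ((-(1 / (4 * τ)) * ‖x‖ ^ 2 : ℝ) : ℂ) := by
      push_cast; ring
    rw [this, Complex.re_mul_ofReal]
    ring
  rw [e1, e2]
  ring

theorem measurable_heatIntegrand (ζ : ℂ) (ξ : Plane) :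
    Measurable fun p : Plane × ℝ => heatIntegrand ζ ξ p.1 p.2 := by
  have h1 : Continuous fun p : Plane × ℝ => (Real.fourierChar (-inner ℝ p.1 ξ) : ℂ) := by
    have := Real.continuous_fourierChar
    fun_prop
  have h2 : Measurable fun p : Plane × ℝ => Complex.exp (-ζ * p.2)
      * Complex.exp (-(ζ / (4 * p.2)) * ((‖p.1‖ : ℝ) : ℂ) ^ 2) / (p.2 : ℂ) := by
    fun_prop
  exact h1.measurable.mul h2

theorem integrable_gaussian_plane {b : ℝ} (hb : 0 < b) :
    Integrable (fun x : Plane => Real.exp (-b * ‖x‖ ^ 2)) ∧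
    ∫ x : Plane, Real.exp (-b * ‖x‖ ^ 2) = Real.pi / b := by
  have h1 := GaussianFourier.integral_rexp_neg_mul_sq_norm (V := Plane) hb
  rw [finrank_plane, show ((2 : ℕ) : ℝ) / 2 = 1 by norm_num, Real.rpow_one] at h1
  refine ⟨?_, h1⟩
  -- The Bochner integral of a non-integrable function is `0`, whereas the value found is positive.
  by_contra h
  rw [integral_undef h] at h1
  have : 0 < Real.pi / b := div_pos Real.pi_pos hb
  linarith

/-- The Gaussian has mass `4πτ / Re ζ`, which cancels the `1/τ` and leaves a multiple of `exp(-Re ζ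
· τ)`. -/
theorem integrable_heatIntegrand {ζ : ℂ} (hζ : 0 < ζ.re) (ξ : Plane) :
    Integrable (fun p : Plane × ℝ => heatIntegrand ζ ξ p.1 p.2)
      ((volume : Measure Plane).prod (volume.restrict (Ioi 0))) := by
  have hgauss : ∀ τ : ℝ, 0 < τ → 0 < ζ.re / (4 * τ) := fun τ hτ => by positivity
  rw [integrable_prod_iff' (measurable_heatIntegrand ζ ξ).aestronglyMeasurable]
  refine ⟨(ae_restrict_mem measurableSet_Ioi).mono fun τ hτ => ?_, ?_⟩
  · have hm : Measurable (fun x : Plane => heatIntegrand ζ ξ x τ) :=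
      Measurable.comp (f := fun x : Plane => (x, τ)) (measurable_heatIntegrand ζ ξ)
        (by fun_prop)
    have hg := (integrable_gaussian_plane (hgauss τ hτ)).1.const_mul (Real.exp (-ζ.re * τ) / τ)
    have hle : ∀ᵐ x : Plane, ‖heatIntegrand ζ ξ x τ‖
        ≤ Real.exp (-ζ.re * τ) / τ * Real.exp (-(ζ.re / (4 * τ)) * ‖x‖ ^ 2) :=
      ae_of_all _ fun x => (norm_heatIntegrand ζ ξ x hτ).le
    exact Integrable.mono' hg hm.aestronglyMeasurable hle
  · have h1 := (integrableOn_exp_mul_Ioi (a := -ζ.re) (by linarith) 0).const_mul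
      (4 * Real.pi / ζ.re)
    refine h1.congr ((ae_restrict_mem measurableSet_Ioi).mono fun τ hτ => ?_)
    have hτ' : (0 : ℝ) < τ := hτ
    simp only [norm_heatIntegrand ζ ξ _ hτ']
    rw [integral_const_mul, (integrable_gaussian_plane (hgauss τ hτ)).2]
    field_simp

/-- By Fubini one transforms Gaussians of complex parameter `ζ/(4τ)` and then integrates an
exponential in `τ`, which gives `1/(ζ(ζ + 4π²|ξ|²/ζ))`. -/
theorem fourier_greenKernel {z : ℂ} (hz : 0 < z.im) (ξ : Plane) :
    𝓕 (greenKernel z) ξ = 1 / symb z ξ := by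
  set ζ := -Complex.I * z with hζdef
  have hζ : 0 < ζ.re := by rwa [hζdef, re_neg_I_mul]
  have hζ0 : ζ ≠ 0 := fun e => by rw [e] at hζ; simp at hζ
  have hpi : (Real.pi : ℂ) ≠ 0 := by exact_mod_cast Real.pi_ne_zero
  have h1 : 𝓕 (greenKernel z) ξ = ∫ x : Plane, 1 / (4 * (Real.pi : ℂ)) *
      ∫ τ in Ioi (0 : ℝ), heatIntegrand ζ ξ x τ := by
    rw [Real.fourier_eq]
    refine integral_congr_ae ?_
    filter_upwards [ae_ne_zero_plane] with x hx
    rw [greenKernel_eq_besselK, besselK_eq_heat hζ (norm_pos_iff.2 hx)]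
    simp only [heatIntegrand, Circle.smul_def, smul_eq_mul]
    rw [integral_const_mul]
    field_simp
    ring_nf
  have h2 : ∀ τ ∈ Ioi (0 : ℝ), ∫ x : Plane, heatIntegrand ζ ξ x τ
      = 4 * (Real.pi : ℂ) / ζ
        * Complex.exp (-(ζ + ((4 * Real.pi ^ 2 * ‖ξ‖ ^ 2 : ℝ) : ℂ) / ζ) * τ) := by
    intro τ hτ
    have hτ' : (0 : ℝ) < τ := hτ
    have hτc : (τ : ℂ) ≠ 0 := by exact_mod_cast hτ'.ne'
    have hb : 0 < (ζ / (4 * (τ : ℂ))).re := by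
      rw [show ζ / (4 * (τ : ℂ)) = ζ * ((1 / (4 * τ) : ℝ) : ℂ) by push_cast; ring,
        Complex.re_mul_ofReal]
      positivity
    have h3 := fourier_gaussian_innerProductSpace (V := Plane) hb ξ
    rw [finrank_plane, Real.fourier_eq, show ((2 : ℕ) : ℂ) / 2 = 1 by norm_num,
      Complex.cpow_one] at h3
    have h4 : ∀ x : Plane, heatIntegrand ζ ξ x τ
        = Complex.exp (-ζ * τ) / τ * (Real.fourierChar (-inner ℝ x ξ) •
          Complex.exp (-(ζ / (4 * τ)) * ((‖x‖ : ℝ) : ℂ) ^ 2)) := fun x => by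
      simp only [heatIntegrand, Circle.smul_def, smul_eq_mul]
      ring
    simp only [h4]
    rw [integral_const_mul, h3]
    push_cast
    rw [neg_add, add_mul, Complex.exp_add]
    rw [show -(Real.pi : ℂ) ^ 2 * ((‖ξ‖ : ℝ) : ℂ) ^ 2 / (ζ / (4 * (τ : ℂ)))
      = -(4 * (Real.pi : ℂ) ^ 2 * ((‖ξ‖ : ℝ) : ℂ) ^ 2 / ζ) * τ by field_simp]
    field_simp
  have h5 := re_add_div_pos hζ (A := 4 * Real.pi ^ 2 * ‖ξ‖ ^ 2) (by positivity)
  rw [h1, integral_const_mul, integral_integral_swap (integrable_heatIntegrand hζ ξ),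
    setIntegral_congr_fun measurableSet_Ioi h2, integral_const_mul,
    integral_exp_mul_complex_Ioi (by rw [Complex.neg_re]; linarith), symb_eq hz]
  have h6 : ζ + ((4 * Real.pi ^ 2 * ‖ξ‖ ^ 2 : ℝ) : ℂ) / ζ ≠ 0 := fun e => by
    rw [e] at h5; simp at h5
  rw [← hζdef]
  generalize ζ + ((4 * Real.pi ^ 2 * ‖ξ‖ ^ 2 : ℝ) : ℂ) / ζ = w at h6 ⊢
  simp
  field_simp

/-! ### The Fourier transform on `L²` and tempered distributions -/

theorem ae_eq_of_integral_schwartz_eq {f g : Plane → ℂ} (hf : LocallyIntegrable f)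
    (hg : LocallyIntegrable g) (h : ∀ φ : 𝓢(Plane, ℂ), ∫ x, φ x * f x = ∫ x, φ x * g x) :
    f =ᵐ[volume] g := by
  refine ae_eq_of_integral_contDiff_smul_eq hf hg fun φ hφ hc => ?_
  have hc' : HasCompactSupport (Complex.ofRealCLM ∘ φ) := hc.comp_left rfl
  have hφ' : ContDiff ℝ ∞ (Complex.ofRealCLM ∘ φ) := by fun_prop
  simpa using h (hc'.toSchwartzMap hφ')

theorem locallyIntegrable_Lp (f : L2Plane) : LocallyIntegrable (f : Plane → ℂ) :=
  (Lp.memLp f).locallyIntegrable (by norm_num)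

theorem toTemperedDistribution_apply_eq (f : L2Plane) (φ : 𝓢(Plane, ℂ)) :
    (f : 𝓢'(Plane, ℂ)) φ = ∫ x, φ x * f x := by
  simp

/-- Against Schwartz functions, both transforms move onto the test function. -/
theorem fourier_toLp_ae_eq {f : Plane → ℂ} (h1 : Integrable f) (h2 : MemLp f 2) :
    ((𝓕 (h2.toLp f) : L2Plane) : Plane → ℂ) =ᵐ[volume] 𝓕 f := by
  have hcont : Continuous (𝓕 f) :=
    VectorFourier.fourierIntegral_continuous Real.continuous_fourierChar continuous_inner h1
  refine ae_eq_of_integral_schwartz_eq (locallyIntegrable_Lp _) hcont.locallyIntegrable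
    fun φ => ?_
  rw [← toTemperedDistribution_apply_eq, ← Lp.fourier_toTemperedDistribution_eq,
    TemperedDistribution.fourier_apply, toTemperedDistribution_apply_eq]
  have e : ∫ x, (𝓕 φ : 𝓢(Plane, ℂ)) x * (h2.toLp f : L2Plane) x
      = ∫ x, (𝓕 (φ : Plane → ℂ)) x * f x := by
    refine integral_congr_ae ?_
    filter_upwards [h2.coeFn_toLp] with x hx
    rw [hx, SchwartzMap.fourier_coe]
  rw [e]
  have := VectorFourier.integral_fourierIntegral_smul_eq_flip (L := innerₗ Plane)
    (μ := volume) (ν := volume) Real.continuous_fourierChar continuous_inner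
    (φ.integrable (μ := volume)) h1
  rw [flip_innerₗ] at this
  exact this

theorem smulLeftCLM_eq_iff {g : Plane → ℂ} (hg : g.HasTemperateGrowth) (f h : L2Plane) :
    TemperedDistribution.smulLeftCLM ℂ g (f : 𝓢'(Plane, ℂ)) = (h : 𝓢'(Plane, ℂ)) ↔
      (h : Plane → ℂ) =ᵐ[volume] fun x => g x * f x := by
  have key : ∀ φ : 𝓢(Plane, ℂ), TemperedDistribution.smulLeftCLM ℂ g (f : 𝓢'(Plane, ℂ)) φ
      = ∫ x, φ x * (g x * f x) := fun φ => by
    rw [TemperedDistribution.smulLeftCLM_apply_apply, toTemperedDistribution_apply_eq]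
    refine integral_congr_ae (ae_of_all _ fun x => ?_)
    simp only [SchwartzMap.smulLeftCLM_apply_apply hg, smul_eq_mul]
    ring
  constructor
  · intro e
    refine ae_eq_of_integral_schwartz_eq (locallyIntegrable_Lp _) ?_ fun φ => ?_
    · exact (locallyIntegrable_Lp f).continuous_mul hg.1.continuous
    · rw [← key, e, toTemperedDistribution_apply_eq]
  · intro e
    ext φ
    rw [key, toTemperedDistribution_apply_eq]
    refine integral_congr_ae ?_
    filter_upwards [e] with x hx
    rw [hx]

theorem hasTemperateGrowth_symb (z : ℂ) : (symb z).HasTemperateGrowth := by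
  have : symb z = fun ξ : Plane => ((4 * Real.pi ^ 2 : ℝ) : ℂ) * ((‖ξ‖ ^ 2 : ℝ) : ℂ) - z ^ 2 := by
    funext ξ; simp [symb]
  rw [this]
  fun_prop

theorem fourier_neg_laplacian_sub (T : 𝓢'(Plane, ℂ)) (z : ℂ) :
    𝓕 (-Δ T - z ^ 2 • T) = TemperedDistribution.smulLeftCLM ℂ (symb z) (𝓕 T) := by
  have e : symb z = ((4 * Real.pi ^ 2 : ℝ) : ℂ) • (fun ξ : Plane => ((‖ξ‖ ^ 2 : ℝ) : ℂ))
      - fun _ => z ^ 2 := by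
    funext ξ; simp [symb]
  have h1 : (fun ξ : Plane => ((‖ξ‖ ^ 2 : ℝ) : ℂ)).HasTemperateGrowth := by fun_prop
  have h2 : (((4 * Real.pi ^ 2 : ℝ) : ℂ)
      • (fun ξ : Plane => ((‖ξ‖ ^ 2 : ℝ) : ℂ))).HasTemperateGrowth := by
    simp only [Pi.smul_def, smul_eq_mul]
    fun_prop
  rw [e, TemperedDistribution.smulLeftCLM_sub h2 (by fun_prop),
    TemperedDistribution.smulLeftCLM_smul h1]
  rw [TemperedDistribution.laplacian_eq_fourierMultiplierCLM,
    TemperedDistribution.fourierMultiplierCLM_apply]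
  generalize hS : TemperedDistribution.smulLeftCLM ℂ (fun ξ : Plane => ((‖ξ‖ ^ 2 : ℝ) : ℂ)) (𝓕 T)
    = S
  have e1 : -(-(2 * Real.pi) ^ 2 • (𝓕⁻ S : 𝓢'(Plane, ℂ)))
      = ((4 * Real.pi ^ 2 : ℝ) : ℂ) • (𝓕⁻ S : 𝓢'(Plane, ℂ)) := by
    ext φ
    change -((-(2 * Real.pi) ^ 2 : ℝ) • ((𝓕⁻ S : 𝓢'(Plane, ℂ)) φ : ℂ))
      = ((4 * Real.pi ^ 2 : ℝ) : ℂ) • ((𝓕⁻ S : 𝓢'(Plane, ℂ)) φ : ℂ)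
    rw [Complex.coe_smul, ← neg_smul]
    ring_nf
  have e2 : -(z ^ 2 • T) = (-z ^ 2) • T := by
    ext φ
    exact (neg_smul (z ^ 2) (T φ)).symm
  rw [e1, sub_eq_add_neg, e2, FourierTransform.fourier_add, FourierTransform.fourier_smul,
    FourierTransform.fourier_smul,
    fourier_fourierInv_eq]
  simp only [sub_apply, smul_apply, hS,
    TemperedDistribution.smulLeftCLM_const]
  ext φ
  change ((4 * Real.pi ^ 2 : ℝ) : ℂ) • S φ + (-z ^ 2) • (𝓕 T) φ
    = ((4 * Real.pi ^ 2 : ℝ) : ℂ) • S φ - z ^ 2 • (𝓕 T) φ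
  rw [neg_smul, ← sub_eq_add_neg]

/-- `w = -Δv - z²v` on the Fourier side. -/
theorem eq_neg_laplacian_sub_iff (v w : L2Plane) (z : ℂ) :
    (w : 𝓢'(Plane, ℂ)) = -Δ (v : 𝓢'(Plane, ℂ)) - z ^ 2 • (v : 𝓢'(Plane, ℂ)) ↔
      ((𝓕 w : L2Plane) : Plane → ℂ) =ᵐ[volume] fun ξ => symb z ξ * (𝓕 v : L2Plane) ξ := by
  rw [← smulLeftCLM_eq_iff (hasTemperateGrowth_symb z), ← Lp.fourier_toTemperedDistribution_eq,
    ← Lp.fourier_toTemperedDistribution_eq, ← fourier_neg_laplacian_sub]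
  constructor
  · intro h; rw [h]
  · intro h
    have := congrArg (fun T : 𝓢'(Plane, ℂ) => (𝓕⁻ T : 𝓢'(Plane, ℂ))) h
    simpa using this.symm

theorem memSobolev_two_of_fourier_eq {v w : L2Plane} {z : ℂ}
    (h : ((𝓕 w : L2Plane) : Plane → ℂ) =ᵐ[volume] fun ξ => symb z ξ * (𝓕 v : L2Plane) ξ) :
    TemperedDistribution.MemSobolev 2 2 (v : 𝓢'(Plane, ℂ)) := by
  rw [TemperedDistribution.memSobolev_iff_exists_smulLeftCLM_fourier]
  -- The hypothesis gives `|ξ|² v̂ = (ŵ + z² v̂)/(4π²)`, so this witness is `(1 + |ξ|²) v̂`.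
  refine ⟨(𝓕 v : L2Plane) + (1 / (4 * (Real.pi : ℂ) ^ 2)) • ((𝓕 w : L2Plane)
    + z ^ 2 • (𝓕 v : L2Plane)), ?_⟩
  rw [Lp.fourier_toTemperedDistribution_eq, smulLeftCLM_eq_iff (by fun_prop)]
  filter_upwards [h, Lp.coeFn_add (𝓕 v : L2Plane) ((1 / (4 * (Real.pi : ℂ) ^ 2)) •
    ((𝓕 w : L2Plane) + z ^ 2 • (𝓕 v : L2Plane))),
    Lp.coeFn_smul (1 / (4 * (Real.pi : ℂ) ^ 2)) ((𝓕 w : L2Plane) + z ^ 2 • (𝓕 v : L2Plane)),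
    Lp.coeFn_add (𝓕 w : L2Plane) (z ^ 2 • (𝓕 v : L2Plane)),
    Lp.coeFn_smul (z ^ 2) (𝓕 v : L2Plane)] with ξ h0 h1 h2 h3 h4
  have hpi : (Real.pi : ℂ) ≠ 0 := by exact_mod_cast Real.pi_ne_zero
  rw [h1, Pi.add_apply, h2, Pi.smul_apply, h3, Pi.add_apply, h4, Pi.smul_apply, h0, symb]
  simp only [smul_eq_mul, div_self (two_ne_zero' ℝ), Real.rpow_one]
  push_cast
  field_simp
  ring

theorem fourier_greenKernel_sub {z : ℂ} (hz : 0 < z.im) (y ξ : Plane) :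
    𝓕 (fun x => greenKernel z (x - y)) ξ = (Real.fourierChar (-inner ℝ y ξ) : ℂ) / symb z ξ := by
  have h := congrFun (VectorFourier.fourierIntegral_comp_add_right Real.fourierChar volume
    (innerₗ Plane) (greenKernel z) (-y)) ξ
  have h2 := fourier_greenKernel hz ξ
  simp only [Function.comp_def, ← sub_eq_add_neg, innerₗ_apply_apply, inner_neg_left,
    Circle.smul_def, smul_eq_mul] at h
  refine h.trans ?_
  rw [div_eq_mul_one_div, ← h2]
  rfl

theorem memLp_greenKernel_sub {z : ℂ} (hz : 0 < z.im) (y : Plane) :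
    MemLp (fun x => greenKernel z (x - y)) 2 (volume : Measure Plane) :=
  (memLp_two_greenKernel hz).comp_measurePreserving (measurePreserving_sub_right volume y)

theorem integrable_greenKernel_sub {z : ℂ} (hz : 0 < z.im) (y : Plane) :
    Integrable (fun x => greenKernel z (x - y)) (volume : Measure Plane) :=
  (integrable_greenKernel hz).comp_sub_right y


variable {N : ℕ}

/-- The exponential sum `∑_j q_j exp (-2πi y_j·ξ)`. -/
def expSum (y : Fin N → Plane) (q : Fin N → ℂ) (ξ : Plane) : ℂ :=
  ∑ j, q j * (Real.fourierChar (-inner ℝ (y j) ξ) : ℂ)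

theorem memLp_greenSum {z : ℂ} (hz : 0 < z.im) (y : Fin N → Plane) (q : Fin N → ℂ) :
    MemLp (fun x => ∑ j, q j * greenKernel z (x - y j)) 2 (volume : Measure Plane) :=
  memLp_finsetSum _ fun j _ => (memLp_greenKernel_sub hz (y j)).const_mul (q j)

theorem fourier_greenSum {z : ℂ} (hz : 0 < z.im) (y : Fin N → Plane) (q : Fin N → ℂ) :
    ((𝓕 ((memLp_greenSum hz y q).toLp _) : L2Plane) : Plane → ℂ) =ᵐ[volume]
      fun ξ => expSum y q ξ / symb z ξ := by
  have hint : ∀ j ∈ Finset.univ, Integrable (fun x => q j * greenKernel z (x - y j)) :=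
    fun j _ => (integrable_greenKernel_sub hz (y j)).const_mul (q j)
  refine (fourier_toLp_ae_eq (integrable_finsetSum _ hint) _).trans (ae_of_all _ fun ξ => ?_)
  simp only
  have hint2 : ∀ j ∈ Finset.univ, Integrable (fun x => Real.fourierChar (-inner ℝ x ξ) •
      (q j * greenKernel z (x - y j))) := fun j hj =>
    (Real.fourierIntegral_convergent_iff ξ).2 (hint j hj)
  rw [Real.fourier_eq]
  simp only [Finset.smul_sum]
  rw [integral_finsetSum _ hint2, expSum, Finset.sum_div]
  refine Finset.sum_congr rfl fun j _ => ?_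
  rw [mul_div_assoc, ← fourier_greenKernel_sub hz, Real.fourier_eq, ← integral_const_mul]
  refine integral_congr_ae (ae_of_all _ fun x => ?_)
  simp only [Circle.smul_def, smul_eq_mul]
  ring

/-! ### Moments of exponential sums -/

/-- The linear form `ξ ↦ ∑_j q_j y_j·ξ`. -/
def momentForm (y : Fin N → Plane) (q : Fin N → ℂ) (ξ : Plane) : ℂ :=
  ∑ j, q j * ((inner ℝ (y j) ξ : ℝ) : ℂ)

theorem momentForm_eq (y : Fin N → Plane) (q : Fin N → ℂ) (ξ : Plane) :
    momentForm y q ξ = (∑ j, q j * ((y j 0 : ℝ) : ℂ)) * ((ξ 0 : ℝ) : ℂ)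
      + (∑ j, q j * ((y j 1 : ℝ) : ℂ)) * ((ξ 1 : ℝ) : ℂ) := by
  rw [momentForm, Finset.sum_mul, Finset.sum_mul, ← Finset.sum_add_distrib]
  refine Finset.sum_congr rfl fun j _ => ?_
  rw [PiLp.inner_apply, Fin.sum_univ_two]
  simp only [RCLike.inner_apply, conj_trivial]
  push_cast
  ring

theorem norm_cexp_sub_one_sub_le (θ : ℝ) :
    ‖Complex.exp (Complex.I * θ) - 1 - Complex.I * θ‖ ≤ 2 * θ ^ 2 := by
  have hn : ‖Complex.I * (θ : ℂ)‖ = |θ| := by simp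
  rcases le_or_gt |θ| 1 with h | h
  · have := Complex.norm_exp_sub_one_sub_id_le (x := Complex.I * θ) (by rwa [hn])
    rw [hn, sq_abs] at this
    nlinarith [sq_nonneg θ]
  · have h1 : ‖Complex.exp (Complex.I * θ) - 1‖ ≤ ‖θ‖ := Real.norm_exp_I_mul_ofReal_sub_one_le
    have h2 := norm_sub_le (Complex.exp (Complex.I * θ) - 1) (Complex.I * θ)
    rw [hn] at h2
    rw [Real.norm_eq_abs] at h1
    rw [← sq_abs]
    nlinarith

theorem fourierChar_neg_inner (y ξ : Plane) : (Real.fourierChar (-inner ℝ y ξ) : ℂ)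
    = Complex.exp (Complex.I * ((-(2 * Real.pi * inner ℝ y ξ) : ℝ) : ℂ)) := by
  rw [Real.fourierChar_apply, mul_comm]
  congr 3
  ring

theorem norm_expSum_le (y : Fin N → Plane) (q : Fin N → ℂ) (ξ : Plane) :
    ‖expSum y q ξ‖ ≤ ∑ j, ‖q j‖ := by
  refine (norm_sum_le _ _).trans (le_of_eq (Finset.sum_congr rfl fun j _ => ?_))
  rw [norm_mul, Circle.norm_coe, mul_one]

theorem norm_expSum_sub_le (y : Fin N → Plane) (q : Fin N → ℂ) (ξ : Plane) :
    ‖expSum y q ξ - (∑ j, q j - 2 * Real.pi * Complex.I * momentForm y q ξ)‖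
      ≤ (∑ j, ‖q j‖ * (2 * (2 * Real.pi * ‖y j‖) ^ 2)) * ‖ξ‖ ^ 2 := by
  have e : expSum y q ξ - (∑ j, q j - 2 * Real.pi * Complex.I * momentForm y q ξ)
      = ∑ j, q j * (Complex.exp (Complex.I * ((-(2 * Real.pi * inner ℝ (y j) ξ) : ℝ) : ℂ)) - 1
        - Complex.I * ((-(2 * Real.pi * inner ℝ (y j) ξ) : ℝ) : ℂ)) := by
    rw [expSum, momentForm, Finset.mul_sum, ← Finset.sum_sub_distrib, ← Finset.sum_sub_distrib]
    refine Finset.sum_congr rfl fun j _ => ?_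
    rw [fourierChar_neg_inner]
    push_cast
    ring
  rw [e, Finset.sum_mul]
  refine (norm_sum_le _ _).trans (Finset.sum_le_sum fun j _ => ?_)
  rw [norm_mul, mul_assoc ‖q j‖]
  refine mul_le_mul_of_nonneg_left ((norm_cexp_sub_one_sub_le _).trans ?_) (norm_nonneg (q j))
  have h := abs_real_inner_le_norm (y j) ξ
  have h2 : (inner ℝ (y j) ξ : ℝ) ^ 2 ≤ (‖y j‖ * ‖ξ‖) ^ 2 := by
    rw [← sq_abs]
    gcongr
  have h3 : (0 : ℝ) ≤ (2 * Real.pi) ^ 2 := by positivity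
  calc 2 * (-(2 * Real.pi * inner ℝ (y j) ξ)) ^ 2
      = 2 * ((2 * Real.pi) ^ 2 * inner ℝ (y j) ξ ^ 2) := by ring
    _ ≤ 2 * ((2 * Real.pi) ^ 2 * (‖y j‖ * ‖ξ‖) ^ 2) := by gcongr
    _ = _ := by ring

/-- The Taylor remainder gives order `|ξ|²` at the origin and the trivial bound controls large `ξ`;
adding them gives one inequality for both regimes. -/
theorem exists_norm_expSum_le {y : Fin N → Plane} {q : Fin N → ℂ} (h0 : ∑ j, q j = 0)
    (h1 : ∀ i : Fin 2, ∑ j, q j * ((y j i : ℝ) : ℂ) = 0) :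
    ∃ C : ℝ, 0 ≤ C ∧ ∀ ξ, ‖expSum y q ξ‖ * (1 + ‖ξ‖ ^ 2) ≤ C * ‖ξ‖ ^ 2 := by
  refine ⟨(∑ j, ‖q j‖ * (2 * (2 * Real.pi * ‖y j‖) ^ 2)) + ∑ j, ‖q j‖, ?_, fun ξ => ?_⟩
  · exact add_nonneg (Finset.sum_nonneg fun j _ => by positivity)
      (Finset.sum_nonneg fun j _ => by positivity)
  have hm : momentForm y q ξ = 0 := by
    rw [momentForm_eq, h1 0, h1 1]; ring
  have h2 := norm_expSum_sub_le y q ξ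
  rw [h0, hm, mul_zero, sub_zero, sub_zero] at h2
  have h3 := mul_le_mul_of_nonneg_right (norm_expSum_le y q ξ) (sq_nonneg ‖ξ‖)
  rw [mul_add, mul_one, add_mul]
  linarith

theorem continuous_fourierChar_neg_inner (y : Plane) :
    Continuous fun ξ : Plane => (Real.fourierChar (-inner ℝ y ξ) : ℂ) := by
  have := Real.continuous_fourierChar
  fun_prop

theorem continuous_expSum (y : Fin N → Plane) (q : Fin N → ℂ) : Continuous (expSum y q) :=
  continuous_finsetSum _ fun j _ => continuous_const.mul (continuous_fourierChar_neg_inner (y j))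

theorem continuous_symb (z : ℂ) : Continuous (symb z) := by
  unfold symb
  fun_prop

theorem memLp_inv_one_add_sq (C : ℝ) :
    MemLp (fun ξ : Plane => C / (1 + ‖ξ‖ ^ 2)) 2 (volume : Measure Plane) := by
  have hm : Measurable fun ξ : Plane => C / (1 + ‖ξ‖ ^ 2) := by fun_prop
  rw [memLp_two_iff_integrable_sq hm.aestronglyMeasurable]
  have := (integrable_rpow_neg_one_add_norm_sq (μ := (volume : Measure Plane)) (r := 4)
    (by rw [finrank_plane]; norm_num)).const_mul (C ^ 2)
  refine this.congr (ae_of_all _ fun ξ => ?_)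
  simp only
  rw [show (-4 / 2 : ℝ) = -((2 : ℕ) : ℝ) by norm_num, Real.rpow_neg (by positivity),
    Real.rpow_natCast, div_pow]
  rfl

/-- The majorant does not depend on `κ` and covers `κ = 0`, as dominated convergence for `κ → 0`
requires. -/
theorem norm_expSum_div_symb_le {y : Fin N → Plane} {q : Fin N → ℂ} {C : ℝ} (hC : 0 ≤ C)
    (h : ∀ ξ, ‖expSum y q ξ‖ * (1 + ‖ξ‖ ^ 2) ≤ C * ‖ξ‖ ^ 2) (κ : ℝ) (ξ : Plane) :
    ‖expSum y q ξ / symb (Complex.I * κ) ξ‖ ≤ C / (1 + ‖ξ‖ ^ 2) := by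
  have e : symb (Complex.I * κ) ξ = ((4 * Real.pi ^ 2 * ‖ξ‖ ^ 2 + κ ^ 2 : ℝ) : ℂ) := by
    rw [symb, mul_pow, Complex.I_sq]; push_cast; ring
  rw [e, norm_div, Complex.norm_real, Real.norm_of_nonneg (by positivity)]
  rcases eq_or_ne ξ 0 with rfl | hξ
  · have h0 := h 0
    simp only [norm_zero, ne_eq, OfNat.ofNat_ne_zero, not_false_eq_true, zero_pow, add_zero,
      mul_one, mul_zero] at h0
    rw [le_antisymm h0 (norm_nonneg _), zero_div]
    positivity
  have hξ' : 0 < ‖ξ‖ := norm_pos_iff.2 hξ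
  have hpi := Real.pi_gt_three
  rw [div_le_div_iff₀ (by positivity) (by positivity)]
  refine (h ξ).trans (mul_le_mul_of_nonneg_left ?_ hC)
  have hpi2 : 1 ≤ 4 * Real.pi ^ 2 := by nlinarith
  nlinarith [sq_nonneg κ, mul_le_mul_of_nonneg_right hpi2 (sq_nonneg ‖ξ‖)]

/-! ### Square integrability at the origin forces the moments to vanish -/

/-- In polar coordinates the radial density is `r^(s+1)`, integrable at `0` only for `s > -2`. -/
theorem not_integrableOn_ball_rpow {c : ℝ} (hc : c ≠ 0) {s : ℝ} (hs : s ≤ -2) :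
    ¬ IntegrableOn (fun ξ : Plane => c * ‖ξ‖ ^ s) (Metric.ball 0 1) := by
  intro h
  have h1 := (integrableOn_fun_norm_addHaar (volume : Measure Plane)
    (f := fun r : ℝ => c * r ^ s) (r := 1)).1 h
  rw [finrank_plane] at h1
  have h2 : IntegrableOn (fun r : ℝ => r ^ (s + 1)) (Ioo 0 1) := by
    refine (IntegrableOn.congr_fun (h1.const_mul c⁻¹) (fun r hr => ?_) measurableSet_Ioo)
    simp only [smul_eq_mul, Nat.add_one_sub_one, pow_one]
    rw [Real.rpow_add_one hr.1.ne']
    field_simp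
  have := (intervalIntegral.integrableOn_Ioo_rpow_iff one_pos).1 h2
  linarith

theorem memLp_ball_comp {f : Plane → ℂ} (hf : MemLp f 2 (volume.restrict (Metric.ball 0 1)))
    (e : Plane ≃ₗᵢ[ℝ] Plane) : MemLp (fun x => f (e x)) 2 (volume.restrict (Metric.ball 0 1)) := by
  have := e.measurePreserving.restrict_preimage (s := Metric.ball (0 : Plane) 1)
    Metric.isOpen_ball.measurableSet
  have he : e ⁻¹' Metric.ball (0 : Plane) 1 = Metric.ball 0 1 := by
    ext x; simp
  rw [he] at this
  exact hf.comp_measurePreserving this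

/-- Rotation of the plane by a right angle. -/
def quarterTurn : Plane ≃ₗᵢ[ℝ] Plane where
  toFun x := !₂[-x 1, x 0]
  invFun x := !₂[x 1, -x 0]
  map_add' x y := by ext i; fin_cases i <;> simp [add_comm]
  map_smul' c x := by ext i; fin_cases i <;> simp
  left_inv x := by ext i; fin_cases i <;> simp
  right_inv x := by ext i; fin_cases i <;> simp
  norm_map' x := by simp [EuclideanSpace.norm_eq, Fin.sum_univ_two, add_comm]

theorem quarterTurn_apply (x : Plane) : quarterTurn x = !₂[-x 1, x 0] := rfl

theorem normSq_add_normSq_quarterTurn (a b : ℂ) (ξ : Plane) :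
    ‖a * ((ξ 0 : ℝ) : ℂ) + b * ((ξ 1 : ℝ) : ℂ)‖ ^ 2
      + ‖a * ((quarterTurn ξ 0 : ℝ) : ℂ) + b * ((quarterTurn ξ 1 : ℝ) : ℂ)‖ ^ 2
      = (‖a‖ ^ 2 + ‖b‖ ^ 2) * ‖ξ‖ ^ 2 := by
  simp only [quarterTurn_apply, EuclideanSpace.real_norm_sq_eq, Fin.sum_univ_two,
    ← Complex.normSq_eq_norm_sq, Complex.normSq_apply]
  simp
  ring

/-- The second-order Taylor remainder of `expSum`, divided by `|ξ|²`, is bounded, so on the unit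
ball only the affine part matters. Symmetries of the ball then isolate its constant and linear
terms. -/
theorem moments_eq_zero_of_memLp {y : Fin N → Plane} {q : Fin N → ℂ}
    (h : MemLp (fun ξ => expSum y q ξ / ((‖ξ‖ ^ 2 : ℝ) : ℂ)) 2 (volume : Measure Plane)) :
    ∑ j, q j = 0 ∧ ∀ i : Fin 2, ∑ j, q j * ((y j i : ℝ) : ℂ) = 0 := by
  set μ : Measure Plane := volume.restrict (Metric.ball 0 1) with hμ
  have : IsFiniteMeasure μ := ⟨by
    rw [hμ, Measure.restrict_apply_univ]; exact measure_ball_lt_top⟩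
  set A := ∑ j, q j with hA
  set ℓ : Plane → ℂ := fun ξ => 2 * Real.pi * Complex.I * momentForm y q ξ with hℓ
  have hmomc : Continuous (momentForm y q) := by
    unfold momentForm; fun_prop
  have hℓc : Continuous ℓ := continuous_const.mul hmomc
  have hden : Measurable fun ξ : Plane => ((‖ξ‖ ^ 2 : ℝ) : ℂ) := by fun_prop
  have hT : MemLp (fun ξ => (A - ℓ ξ) / ((‖ξ‖ ^ 2 : ℝ) : ℂ)) 2 μ := by
    set C := ∑ j, ‖q j‖ * (2 * (2 * Real.pi * ‖y j‖) ^ 2) with hC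
    have hR : MemLp (fun ξ => (expSum y q ξ - (A - ℓ ξ)) / ((‖ξ‖ ^ 2 : ℝ) : ℂ)) 2 μ := by
      refine MemLp.of_bound ((((continuous_expSum y q).sub
        (continuous_const.sub hℓc)).measurable.div hden).aestronglyMeasurable) C
        (ae_of_all _ fun ξ => ?_)
      rw [norm_div, Complex.norm_real, Real.norm_of_nonneg (by positivity)]
      refine div_le_of_le_mul₀ (by positivity) (Finset.sum_nonneg fun j _ => by positivity) ?_
      exact norm_expSum_sub_le y q ξ
    refine ((h.restrict (Metric.ball 0 1)).sub hR).ae_eq (ae_of_all _ fun ξ => ?_)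
    simp only [Pi.sub_apply]
    ring
  -- The linear part is odd: adding the reflected function leaves `2A/|ξ|²`.
  have hneg := memLp_ball_comp hT (LinearIsometryEquiv.neg ℝ)
  have hodd : ∀ ξ, ℓ (-ξ) = -ℓ ξ := fun ξ => by
    simp [hℓ, momentForm]
  simp only [LinearIsometryEquiv.coe_neg, hodd, norm_neg] at hneg
  have hA0 : A = 0 := by
    by_contra hne
    have h1 : MemLp (fun ξ : Plane => (2 * A) / ((‖ξ‖ ^ 2 : ℝ) : ℂ)) 2 μ :=
      (hT.add hneg).ae_eq (ae_of_all _ fun ξ => by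
        simp only [Pi.add_apply]
        ring)
    have h2 := (memLp_two_iff_integrable_sq_norm h1.1).1 h1
    refine not_integrableOn_ball_rpow (c := ‖2 * A‖ ^ 2) (by simpa using hne)
      (s := -(4 : ℕ)) (by norm_num) (h2.congr (ae_of_all _ fun ξ => ?_))
    simp only
    rw [norm_div, Complex.norm_real, Real.norm_of_nonneg (by positivity),
      Real.rpow_neg (norm_nonneg _), Real.rpow_natCast, div_pow, div_eq_mul_inv]
    ring
  refine ⟨hA0, ?_⟩
  set a := ∑ j, q j * ((y j 0 : ℝ) : ℂ) with ha
  set b := ∑ j, q j * ((y j 1 : ℝ) : ℂ) with hb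
  have hm : MemLp (fun ξ : Plane => momentForm y q ξ / ((‖ξ‖ ^ 2 : ℝ) : ℂ)) 2 μ := by
    refine (hT.const_mul (-(1 / (2 * Real.pi * Complex.I)))).ae_eq (ae_of_all _ fun ξ => ?_)
    have hpi : (Real.pi : ℂ) ≠ 0 := by exact_mod_cast Real.pi_ne_zero
    have hI := Complex.I_ne_zero
    simp only [hA0, hℓ]
    field_simp
    ring
  -- A single linear form may vanish along a line; with its quarter turn the squared moduli add up
  -- to the radial function `(|a|² + |b|²)/|ξ|²`.
  have hm2 := memLp_ball_comp hm quarterTurn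
  have h1 := ((memLp_two_iff_integrable_sq_norm hm.1).1 hm).add
    ((memLp_two_iff_integrable_sq_norm hm2.1).1 hm2)
  have hab : ‖a‖ ^ 2 + ‖b‖ ^ 2 = 0 := by
    by_contra hne
    refine not_integrableOn_ball_rpow (c := ‖a‖ ^ 2 + ‖b‖ ^ 2) hne
      (s := -(2 : ℕ)) (by norm_num) (h1.congr ?_)
    refine ae_restrict_of_ae ?_
    filter_upwards [ae_ne_zero_plane] with ξ hξ
    have hξ' : 0 < ‖ξ‖ := norm_pos_iff.2 hξ
    simp only [Pi.add_apply, LinearIsometryEquiv.norm_map]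
    rw [norm_div, norm_div, Complex.norm_real, Real.norm_of_nonneg (by positivity),
      Real.rpow_neg (norm_nonneg _), Real.rpow_natCast, div_pow, div_pow, ← add_div,
      momentForm_eq, momentForm_eq, normSq_add_normSq_quarterTurn, ← ha, ← hb]
    field_simp
  have ha0 : a = 0 := by
    rw [← norm_eq_zero, ← sq_eq_zero_iff]
    nlinarith [sq_nonneg ‖a‖, sq_nonneg ‖b‖]
  have hb0 : b = 0 := by
    rw [← norm_eq_zero, ← sq_eq_zero_iff]
    nlinarith [sq_nonneg ‖a‖, sq_nonneg ‖b‖]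
  intro i
  fin_cases i
  · exact ha0
  · exact hb0

/-! ### The logarithmic potential as a limit of Green potentials -/

theorem norm_sq_eq_integral (f : L2Plane) : ‖f‖ ^ 2 = ∫ x, ‖f x‖ ^ 2 := by
  have h : ((‖f‖ ^ 2 : ℝ) : ℂ) = ((∫ x, ‖f x‖ ^ 2 : ℝ) : ℂ) := by
    have h1 := inner_self_eq_norm_sq_to_K (𝕜 := ℂ) f
    rw [L2.inner_def] at h1
    rw [Complex.ofReal_pow]
    refine h1.symm.trans ?_
    rw [← integral_complex_ofReal]
    refine integral_congr_ae (ae_of_all _ fun x => ?_)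
    simp [inner_self_eq_norm_sq_to_K]
  exact_mod_cast h

theorem tendsto_L2_of_dominated {F : ℕ → L2Plane} {G : L2Plane} {b : Plane → ℝ} (hb : MemLp b 2)
    (hle : ∀ n, ∀ᵐ x, ‖F n x - G x‖ ≤ b x)
    (hlim : ∀ᵐ x, Tendsto (fun n => F n x) atTop (𝓝 (G x))) : Tendsto F atTop (𝓝 G) := by
  rw [tendsto_iff_norm_sub_tendsto_zero]
  have h1 : Tendsto (fun n => ∫ x, ‖F n x - G x‖ ^ 2) atTop (𝓝 (∫ _ : Plane, (0 : ℝ))) := by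
    refine tendsto_integral_of_dominated_convergence (fun x => b x ^ 2) (fun n => ?_)
      ((memLp_two_iff_integrable_sq hb.1).1 hb) (fun n => ?_) ?_
    · exact ((Lp.aestronglyMeasurable _).sub (Lp.aestronglyMeasurable _)).norm.pow 2
    · filter_upwards [hle n] with x hx
      rw [Real.norm_of_nonneg (by positivity)]
      gcongr
    · filter_upwards [hlim] with x hx
      have := ((hx.sub_const (G x)).norm).pow 2
      simpa using this
  have h2 : ∀ n, ∫ x, ‖F n x - G x‖ ^ 2 = ‖F n - G‖ ^ 2 := fun n => by
    rw [norm_sq_eq_integral]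
    refine integral_congr_ae ?_
    filter_upwards [Lp.coeFn_sub (F n) G] with x hx
    rw [hx, Pi.sub_apply]
  simp only [h2, integral_zero] at h1
  have h3 := h1.sqrt
  simpa [Real.sqrt_sq (norm_nonneg _)] using h3

theorem greenKernel_imaginary {κ : ℝ} (x : Plane) : greenKernel (Complex.I * κ) x
    = 1 / (2 * (Real.pi : ℂ)) * besselK (((‖x‖ : ℝ) : ℂ) * (κ : ℂ)) := by
  rw [greenKernel_eq_besselK]
  congr 2
  linear_combination -(κ : ℂ) * ((‖x‖ : ℝ) : ℂ) * Complex.I_sq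

/-- Each term diverges like `log κ`, but this divergence and the constants `log 2` and `γ` are the
same for all `j` and cancel since `∑ q_j = 0`. -/
theorem tendsto_greenSum_logPotential {y : Fin N → Plane} {q : Fin N → ℂ} (h0 : ∑ j, q j = 0)
    {x : Plane} (hx : ∀ j, x ≠ y j) :
    Tendsto (fun κ : ℝ => ∑ j, q j * greenKernel (Complex.I * κ) (x - y j)) (𝓝[>] 0)
      (𝓝 (logPotential y q x)) := by
  have h1 : ∀ j, Tendsto (fun κ : ℝ => q j * (1 / (2 * (Real.pi : ℂ))) *
      (besselK (((‖x - y j‖ : ℝ) : ℂ) * κ) + (Real.log κ : ℂ))) (𝓝[>] 0)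
      (𝓝 (q j * (1 / (2 * (Real.pi : ℂ))) * (-Complex.log (((‖x - y j‖ : ℝ) : ℂ) / 2)
        - Real.eulerMascheroniConstant))) := fun j => by
    have hpos : 0 < (((‖x - y j‖ : ℝ) : ℂ)).re := by
      rw [Complex.ofReal_re]; exact norm_pos_iff.2 (sub_ne_zero.2 (hx j))
    exact (tendsto_besselK_add_log hpos).const_mul _
  have h2 := tendsto_finsetSum Finset.univ fun j (_ : j ∈ Finset.univ) => h1 j
  have e1 : ∑ j, q j * (1 / (2 * (Real.pi : ℂ))) * (-Complex.log (((‖x - y j‖ : ℝ) : ℂ) / 2)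
      - Real.eulerMascheroniConstant) = logPotential y q x := by
    have e3 : ∀ j, Complex.log (((‖x - y j‖ : ℝ) : ℂ) / 2)
        = (Real.log ‖x - y j‖ : ℂ) - (Real.log 2 : ℂ) := fun j => by
      have hpos : 0 < ‖x - y j‖ := norm_pos_iff.2 (sub_ne_zero.2 (hx j))
      rw [show ((‖x - y j‖ : ℝ) : ℂ) / 2 = ((‖x - y j‖ / 2 : ℝ) : ℂ) by push_cast; rfl,
        ← Complex.ofReal_log (by positivity), Real.log_div hpos.ne' (by norm_num)]
      push_cast
      rfl
    have e4 : ∀ j, q j * (1 / (2 * (Real.pi : ℂ))) * (-Complex.log (((‖x - y j‖ : ℝ) : ℂ) / 2)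
        - Real.eulerMascheroniConstant) = -(q j / (2 * (Real.pi : ℂ)) * (Real.log ‖x - y j‖ : ℂ))
        + q j * ((1 / (2 * (Real.pi : ℂ))) * ((Real.log 2 : ℂ) - Real.eulerMascheroniConstant)) :=
      fun j => by rw [e3]; ring
    simp only [e4]
    rw [Finset.sum_add_distrib, ← Finset.sum_mul, h0, zero_mul, add_zero, logPotential,
      Finset.sum_neg_distrib]
  rw [e1] at h2
  refine h2.congr fun κ => ?_
  have e5 : ∀ j, q j * (1 / (2 * (Real.pi : ℂ))) *
      (besselK (((‖x - y j‖ : ℝ) : ℂ) * κ) + (Real.log κ : ℂ))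
      = q j * greenKernel (Complex.I * κ) (x - y j)
        + q j * ((1 / (2 * (Real.pi : ℂ))) * (Real.log κ : ℂ)) := fun j => by
    rw [greenKernel_imaginary]; ring
  simp only [e5]
  rw [Finset.sum_add_distrib, ← Finset.sum_mul, h0, zero_mul, add_zero]

theorem ae_forall_ne (y : Fin N → Plane) : ∀ᵐ x : Plane, ∀ j, x ≠ y j := by
  rw [ae_all_iff]
  intro j
  simp [ae_iff]

/-- Under the moment conditions the logarithmic potential is square integrable, with Fourier
transform `∑_j q_j exp (-2πi y_j·ξ) / (4π²|ξ|²)`. -/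
theorem exists_fourier_logPotential {y : Fin N → Plane} {q : Fin N → ℂ} (h0 : ∑ j, q j = 0)
    (h1 : ∀ i : Fin 2, ∑ j, q j * ((y j i : ℝ) : ℂ) = 0) :
    ∃ ψ : L2Plane, (ψ : Plane → ℂ) =ᵐ[volume] logPotential y q ∧
      ((𝓕 ψ : L2Plane) : Plane → ℂ) =ᵐ[volume] fun ξ => expSum y q ξ / symb 0 ξ := by
  obtain ⟨C, hC, hbound⟩ := exists_norm_expSum_le h0 h1
  have hb := norm_expSum_div_symb_le hC hbound
  have hb0 : ∀ ξ, ‖expSum y q ξ / symb 0 ξ‖ ≤ C / (1 + ‖ξ‖ ^ 2) := fun ξ => by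
    have := hb 0 ξ
    simpa using this
  have hmem : MemLp (fun ξ => expSum y q ξ / symb 0 ξ) 2 (volume : Measure Plane) :=
    (memLp_inv_one_add_sq C).mono'
      ((continuous_expSum y q).measurable.div (continuous_symb 0).measurable).aestronglyMeasurable
      (ae_of_all _ hb0)
  set ψ : L2Plane := 𝓕⁻ (hmem.toLp _ : L2Plane) with hψ
  have hFψ : (𝓕 ψ : L2Plane) = hmem.toLp _ := fourier_fourierInv_eq _
  have hFψ' : ((𝓕 ψ : L2Plane) : Plane → ℂ) =ᵐ[volume] fun ξ => expSum y q ξ / symb 0 ξ := by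
    rw [hFψ]; exact hmem.coeFn_toLp
  refine ⟨ψ, ?_, hFψ'⟩
  -- The Green sums at `z = iκ_n` converge to `ψ` in `L²`, by dominated convergence on the Fourier
  -- side. A subsequence converges almost everywhere, and its pointwise limit is the logarithmic
  -- potential.
  set κ : ℕ → ℝ := fun n => 1 / ((n : ℝ) + 1) with hκ
  have hκpos : ∀ n, 0 < κ n := fun n => by simp only [hκ]; positivity
  have hκlim : Tendsto κ atTop (𝓝 0) := tendsto_one_div_add_atTop_nhds_zero_nat
  have him : ∀ n, 0 < (Complex.I * κ n).im := fun n => by simpa using hκpos n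
  set F : ℕ → L2Plane := fun n => (memLp_greenSum (him n) y q).toLp _ with hF
  have hFF : Tendsto (fun n => (𝓕 (F n) : L2Plane)) atTop (𝓝 (𝓕 ψ)) := by
    refine tendsto_L2_of_dominated (memLp_inv_one_add_sq (2 * C)) (fun n => ?_) ?_
    · filter_upwards [fourier_greenSum (him n) y q, hFψ'] with ξ e1 e2
      rw [e1, e2]
      refine (norm_sub_le _ _).trans ((add_le_add (hb (κ n) ξ) (hb0 ξ)).trans (le_of_eq ?_))
      ring
    · filter_upwards [ae_all_iff.2 fun n => fourier_greenSum (him n) y q, hFψ',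
        ae_ne_zero_plane] with ξ e1 e2 hξ
      simp only [hF, e1, e2]
      have hs : symb 0 ξ ≠ 0 := by
        have hξ' : ((‖ξ‖ : ℝ) : ℂ) ≠ 0 := by exact_mod_cast (norm_pos_iff.2 hξ).ne'
        have hpi : (Real.pi : ℂ) ≠ 0 := by exact_mod_cast Real.pi_ne_zero
        simp [symb, hξ, hpi]
      refine tendsto_const_nhds.div ?_ hs
      have hc : Continuous fun k : ℝ => symb (Complex.I * k) ξ := by
        unfold symb; fun_prop
      have := (hc.tendsto' 0 (symb 0 ξ) (by simp)).comp hκlim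
      exact this
  have hFψlim : Tendsto F atTop (𝓝 ψ) := by
    have hcont : Continuous fun f : L2Plane => (𝓕⁻ f : L2Plane) :=
      (Lp.fourierTransformₗᵢ Plane ℂ).symm.continuous
    have := (hcont.tendsto (𝓕 ψ)).comp hFF
    simpa [Function.comp_def] using this
  obtain ⟨ns, hns, hlim⟩ := (tendstoInMeasure_of_tendsto_Lp hFψlim).exists_seq_tendsto_ae
  filter_upwards [hlim, ae_forall_ne y,
    ae_all_iff.2 fun n => (memLp_greenSum (him n) y q).coeFn_toLp] with x hx hxy hFx
  refine tendsto_nhds_unique hx ?_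
  simp only [hF, hFx]
  have hκ' : Tendsto (fun i => κ (ns i)) atTop (𝓝[>] 0) :=
    tendsto_nhdsWithin_iff.2 ⟨hκlim.comp hns.tendsto_atTop,
      Eventually.of_forall fun i => hκpos (ns i)⟩
  exact (tendsto_greenSum_logPotential h0 hxy).comp hκ'

/-! ### The regular part of the Green kernel -/

/-- The value at the origin of `-(2π)⁻¹ log |x| - 𝒢_z(x)`. -/
def greenConst (z : ℂ) : ℂ :=
  1 / (2 * (Real.pi : ℂ)) * Complex.log (z / 2) - Complex.I / 4
    + (Real.eulerMascheroniConstant : ℂ) / (2 * (Real.pi : ℂ))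

open Classical in
/-- The continuous extension of `-(2π)⁻¹ log |x| - 𝒢_z(x)` to the plane. -/
def greenRegular (z : ℂ) (x : Plane) : ℂ :=
  if x = 0 then greenConst z
  else -(1 / (2 * (Real.pi : ℂ)) * ((Real.log ‖x‖ : ℝ) : ℂ)) - greenKernel z x

/-- No branch is crossed because `arg(z/2)` lies in `[0, π]`. Divided by `2π`, the shift is the
`-i/4` in the diagonal of `Γ`. -/
theorem log_neg_I_mul_div_two {z : ℂ} (hz : 0 < z.im) :
    Complex.log (-Complex.I * z / 2) = Complex.log (z / 2) - Real.pi / 2 * Complex.I := by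
  have hz2 : 0 < (z / 2).im := by rw [Complex.div_ofNat_im]; linarith
  have hz0 : z / 2 ≠ 0 := fun h => by rw [h] at hz2; simp at hz2
  have h0 : 0 ≤ Complex.arg (z / 2) := Complex.arg_nonneg_iff.2 hz2.le
  have h1 : Complex.arg (z / 2) ≤ Real.pi := Complex.arg_le_pi _
  have hpi := Real.pi_pos
  rw [mul_div_assoc, Complex.log_mul (neg_ne_zero.2 Complex.I_ne_zero) hz0
    (by rw [Complex.arg_neg_I]; constructor <;> linarith), Complex.log_neg_I]
  ring

theorem continuous_greenRegular {z : ℂ} (hz : 0 < z.im) : Continuous (greenRegular z) := by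
  rw [continuous_iff_continuousAt]
  intro x
  rcases eq_or_ne x 0 with rfl | hx
  · rw [continuousAt_iff_punctured_nhds]
    have h := (tendsto_besselK_add_log (ζ := -Complex.I * z) (by rwa [re_neg_I_mul])).comp
      (tendsto_norm_nhdsNE_zero (E := Plane))
    have h2 := h.const_mul (-(1 / (2 * (Real.pi : ℂ))))
    have hpi : (Real.pi : ℂ) ≠ 0 := by exact_mod_cast Real.pi_ne_zero
    have e : -(1 / (2 * (Real.pi : ℂ))) * (-Complex.log (-Complex.I * z / 2)
        - Real.eulerMascheroniConstant) = greenRegular z 0 := by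
      rw [log_neg_I_mul_div_two hz, greenRegular, if_pos rfl, greenConst]
      field_simp
      ring
    rw [e] at h2
    refine h2.congr' ?_
    filter_upwards [self_mem_nhdsWithin] with x hx
    have hx0 : x ≠ 0 := hx
    rw [greenRegular, if_neg hx0, greenKernel_eq_besselK, Function.comp_apply]
    ring
  · have hn : ‖x‖ ≠ 0 := norm_ne_zero_iff.2 hx
    have h1 : ContinuousAt (fun x : Plane => -(1 / (2 * (Real.pi : ℂ)) * ((Real.log ‖x‖ : ℝ) : ℂ))
        - greenKernel z x) x := by
      have h2 : ContinuousAt (fun x : Plane => Real.log ‖x‖) x :=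
        continuous_norm.continuousAt.log hn
      have h3 := Complex.continuous_ofReal.continuousAt.comp h2
      exact (h3.const_mul _).neg.sub (continuousAt_greenKernel hz hx)
    refine h1.congr ?_
    filter_upwards [isOpen_ne.mem_nhds hx] with x hx
    rw [greenRegular, if_neg hx]

/-- The continuous function `∑_j q_j (-(2π)⁻¹ log |x - y_j| - 𝒢_z(x - y_j))`. -/
def regularSum (y : Fin N → Plane) (z : ℂ) (q : Fin N → ℂ) (x : Plane) : ℂ :=
  ∑ j, q j * greenRegular z (x - y j)

theorem continuous_regularSum {z : ℂ} (hz : 0 < z.im) (y : Fin N → Plane) (q : Fin N → ℂ) :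
    Continuous (regularSum y z q) :=
  continuous_finsetSum _ fun _ _ => continuous_const.mul
    ((continuous_greenRegular hz).comp (continuous_id.sub continuous_const))

theorem regularSum_eq {y : Fin N → Plane} {x : Plane} (hx : ∀ j, x ≠ y j) (z : ℂ)
    (q : Fin N → ℂ) :
    regularSum y z q x = logPotential y q x - ∑ j, q j * greenKernel z (x - y j) := by
  rw [regularSum, logPotential, ← Finset.sum_neg_distrib, ← Finset.sum_sub_distrib]
  refine Finset.sum_congr rfl fun j _ => ?_
  rw [greenRegular, if_neg (sub_ne_zero.2 (hx j))]
  ring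

/-- Entry by entry, `Γ(z) - 𝒟̃` is the regular part of the kernel at `y_k - y_j`: `α_k` cancels on
the diagonal, leaving `greenConst z`. -/
theorem regularSum_apply_point (α : Fin N → ℝ) {y : Fin N → Plane} (hy : Function.Injective y)
    (z : ℂ) (q : Fin N → ℂ) (k : Fin N) :
    regularSum y z q (y k) = Matrix.mulVec (gammaMatrix α y z) q k
      - Matrix.mulVec ((dMatrix α y).map Complex.ofReal) q k := by
  simp only [regularSum, Matrix.mulVec, dotProduct]
  rw [← Finset.sum_sub_distrib]
  refine Finset.sum_congr rfl fun j _ => ?_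
  rcases eq_or_ne k j with rfl | h
  · simp only [gammaMatrix, dMatrix, Matrix.of_apply, Matrix.map_apply, if_true, sub_self,
      greenRegular, greenConst]
    ring
  · have hne : y k - y j ≠ 0 := sub_ne_zero.2 (hy.ne h)
    simp only [gammaMatrix, dMatrix, Matrix.of_apply, Matrix.map_apply, if_neg h, greenRegular,
      if_neg hne]
    push_cast
    ring

/-! ### A logarithmic potential that is continuous vanishes -/

/-- If `q k ≠ 0`, solving for `log|x - y_k|` writes it as a function continuous at `y_k`, since the
other logarithms are singular elsewhere. -/
theorem eq_zero_of_logPotential_ae_eq {y : Fin N → Plane} (hy : Function.Injective y)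
    {q : Fin N → ℂ} {f : Plane → ℂ} (hf : Continuous f)
    (h : logPotential y q =ᵐ[volume] f) : q = 0 := by
  funext k
  by_contra hk
  have hk' : q k ≠ 0 := hk
  have hpi : (Real.pi : ℂ) ≠ 0 := by exact_mod_cast Real.pi_ne_zero
  set S : Set Plane := {x | logPotential y q x = f x} ∩ {x | x ≠ y k} with hS
  have hSae : ∀ᵐ x, x ∈ S := by
    filter_upwards [h, ae_forall_ne y] with x h1 h2 using ⟨h1, h2 k⟩
  -- A set of full measure is dense, so `y k` can be approached within `S`, where the equality holds
  -- pointwise.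
  have hdense : Dense S := Measure.dense_of_ae hSae
  have hne : (𝓝[S] (y k)).NeBot := mem_closure_iff_nhdsWithin_neBot.1 (hdense (y k))
  set g : Plane → ℂ := fun x => -(2 * (Real.pi : ℂ) / q k) * (f x
    + ∑ j ∈ Finset.univ.erase k, q j / (2 * (Real.pi : ℂ)) * ((Real.log ‖x - y j‖ : ℝ) : ℂ)) with hg
  have hgc : ContinuousAt g (y k) := by
    refine (hf.continuousAt.add (tendsto_finsetSum _ fun j hj => ?_)).const_mul _
    have hn : ‖y k - y j‖ ≠ 0 :=
      norm_ne_zero_iff.2 (sub_ne_zero.2 (hy.ne (Finset.ne_of_mem_erase hj).symm))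
    have h2 : ContinuousAt (fun x : Plane => Real.log ‖x - y j‖) (y k) :=
      ContinuousAt.log (by fun_prop) hn
    exact (Complex.continuous_ofReal.continuousAt.comp h2).const_mul _
  have heq : ∀ x ∈ S, g x = ((Real.log ‖x - y k‖ : ℝ) : ℂ) := fun x hx => by
    have h1 : logPotential y q x = f x := hx.1
    rw [logPotential, ← Finset.add_sum_erase _ _ (Finset.mem_univ k)] at h1
    simp only [hg]
    rw [← h1]
    field_simp
    ring
  have hlim1 : Tendsto (fun x => ‖g x‖) (𝓝[S] (y k)) (𝓝 ‖g (y k)‖) :=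
    (hgc.tendsto.mono_left nhdsWithin_le_nhds).norm
  have hlim2 : Tendsto (fun x => ‖g x‖) (𝓝[S] (y k)) atTop := by
    have h3 : Tendsto (fun x : Plane => ‖x - y k‖) (𝓝[S] (y k)) (𝓝[>] 0) := by
      refine tendsto_nhdsWithin_iff.2 ⟨?_, ?_⟩
      · have : Continuous fun x : Plane => ‖x - y k‖ := by fun_prop
        exact (this.tendsto' (y k) 0 (by simp)).mono_left nhdsWithin_le_nhds
      · filter_upwards [self_mem_nhdsWithin] with x hx
        exact norm_pos_iff.2 (sub_ne_zero.2 hx.2)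
    have h4 := tendsto_abs_atBot_atTop.comp (Real.tendsto_log_nhdsGT_zero.comp h3)
    refine h4.congr' ?_
    filter_upwards [self_mem_nhdsWithin] with x hx
    rw [heq x hx, Complex.norm_real]
    rfl
  exact not_tendsto_nhds_of_tendsto_atTop hlim2 _ hlim1

/-! ### The set of admissible points is nonempty -/

theorem tendsto_greenKernel_imaginary {x : Plane} (hx : x ≠ 0) :
    Tendsto (fun κ : ℝ => greenKernel (Complex.I * κ) x) atTop (𝓝 0) := by
  have hx' : 0 < ‖x‖ := norm_pos_iff.2 hx
  have h1 : Tendsto (fun κ : ℝ => 1 / √(κ * ‖x‖)) atTop (𝓝 0) := by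
    have := (Real.tendsto_sqrt_atTop.comp (tendsto_id.atTop_mul_const hx'))
    refine this.inv_tendsto_atTop.congr fun κ => ?_
    simp
  refine squeeze_zero_norm' ?_ h1
  filter_upwards [eventually_gt_atTop 0] with κ hκ
  have him : (Complex.I * (κ : ℂ)).im = κ := by simp
  have h2 := norm_greenKernel_le (z := Complex.I * κ) (by rwa [him]) hx
  rw [him] at h2
  refine h2.trans ?_
  gcongr
  have : 0 < κ * ‖x‖ := mul_pos hκ hx'
  exact Real.exp_le_one_iff.2 (by linarith)

theorem gammaMatrix_imaginary_diag (α : Fin N → ℝ) (y : Fin N → Plane) {κ : ℝ} (hκ : 0 < κ)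
    (k : Fin N) : gammaMatrix α y (Complex.I * κ) k k
      = ((α k + 1 / (2 * Real.pi) * (Real.log (κ / 2) + Real.eulerMascheroniConstant) : ℝ) : ℂ) := by
  have hpi : (Real.pi : ℂ) ≠ 0 := by exact_mod_cast Real.pi_ne_zero
  have hl : Complex.log (Complex.I * κ / 2)
      = (Real.log (κ / 2) : ℂ) + Real.pi / 2 * Complex.I := by
    rw [show Complex.I * (κ : ℂ) / 2 = ((κ / 2 : ℝ) : ℂ) * Complex.I by push_cast; ring,
      Complex.log_ofReal_mul (by positivity) Complex.I_ne_zero, Complex.log_I]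
  simp only [gammaMatrix, Matrix.of_apply, if_true]
  rw [hl]
  push_cast
  field_simp
  ring

/-- At `z = iκ` with `κ` large, the diagonal grows like `(2π)⁻¹ log κ` and the other entries tend to
`0`, so `Γ` is strictly diagonally dominant. -/
theorem admissible_nonempty (α : Fin N → ℝ) {y : Fin N → Plane} (hy : Function.Injective y) :
    (admissible α y).Nonempty := by
  have hoff : ∀ k : Fin N, Tendsto (fun κ : ℝ => ∑ j ∈ Finset.univ.erase k,
      ‖gammaMatrix α y (Complex.I * κ) k j‖) atTop (𝓝 0) := fun k => by
    rw [← Finset.sum_const_zero (ι := Fin N) (s := Finset.univ.erase k)]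
    refine tendsto_finsetSum _ fun j hj => ?_
    have hjk : k ≠ j := (Finset.ne_of_mem_erase hj).symm
    have := (tendsto_greenKernel_imaginary (sub_ne_zero.2 (hy.ne hjk))).norm
    simpa only [gammaMatrix, Matrix.of_apply, if_neg hjk, norm_neg, norm_zero] using this
  have hdiag : ∀ k : Fin N, Tendsto (fun κ : ℝ => α k + 1 / (2 * Real.pi)
      * (Real.log (κ / 2) + Real.eulerMascheroniConstant)) atTop atTop := fun k => by
    have h1 : Tendsto (fun κ : ℝ => Real.log (κ / 2)) atTop atTop :=
      Real.tendsto_log_atTop.comp (tendsto_id.atTop_div_const (by norm_num))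
    exact tendsto_atTop_add_const_left _ _
      ((tendsto_atTop_add_const_right _ _ h1).const_mul_atTop (by have := Real.pi_pos; positivity))
  have hev : ∀ᶠ κ : ℝ in atTop, 0 < κ ∧ ∀ k, ∑ j ∈ Finset.univ.erase k,
      ‖gammaMatrix α y (Complex.I * κ) k j‖ < ‖gammaMatrix α y (Complex.I * κ) k k‖ := by
    refine (eventually_gt_atTop 0).and (eventually_all.2 fun k => ?_)
    filter_upwards [(hoff k).eventually (gt_mem_nhds one_pos), (hdiag k).eventually_ge_atTop 1,
      eventually_gt_atTop 0] with κ h1 h2 h3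
    rw [gammaMatrix_imaginary_diag α y h3, Complex.norm_real]
    exact h1.trans_le (h2.trans (le_abs_self _))
  obtain ⟨κ, hκ, hdom⟩ := hev.exists
  refine ⟨Complex.I * κ, by simpa using hκ, ?_⟩
  rw [Matrix.isUnit_iff_isUnit_det, isUnit_iff_ne_zero]
  exact det_ne_zero_of_sum_row_lt_diag hdom

/-! ### The graph of the point interaction -/

theorem domainFunction_eq (α : Fin N → ℝ) (y : Fin N → Plane) (z : ℂ) (v : Plane → ℂ) (x : Plane) :
    domainFunction α y z v x = v x + ∑ j,
      Matrix.mulVec (gammaMatrix α y z)⁻¹ (fun k => v (y k)) j * greenKernel z (x - y j) := by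
  simp only [domainFunction, Matrix.mulVec, dotProduct, Finset.sum_mul]

/-- If `u = 0` then the Green sum equals `-v`, so the logarithmic potential of `q` is almost
everywhere the continuous `regularSum - v`. Hence `q = 0`, then `v = 0`. -/
theorem eq_zero_of_mem_pointInteractionGraphAt {α : Fin N → ℝ} {y : Fin N → Plane}
    (hy : Function.Injective y) {z : ℂ} (hz : z ∈ admissible α y) {p : L2Plane × L2Plane}
    (hp : p ∈ pointInteractionGraphAt α y z) (h0 : p.1 = 0) : p.2 = 0 := by
  obtain ⟨v, vc, -, hvc, hv, hu, he⟩ := hp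
  rw [h0] at hu
  set q := Matrix.mulVec (gammaMatrix α y z)⁻¹ (fun k => vc (y k)) with hq
  have hq0 : q = 0 := by
    refine eq_zero_of_logPotential_ae_eq hy
      ((continuous_regularSum hz.1 y q).sub hvc) ?_
    filter_upwards [hu, Lp.coeFn_zero ℂ 2 (volume : Measure Plane), ae_forall_ne y] with x h1 h2 h3
    rw [h2, Pi.zero_apply, domainFunction_eq] at h1
    rw [Pi.sub_apply, regularSum_eq h3]
    linear_combination -h1
  have hv0 : v = 0 := by
    rw [Lp.eq_zero_iff_ae_eq_zero]
    filter_upwards [hu, Lp.coeFn_zero ℂ 2 (volume : Measure Plane), hv] with x h1 h2 h3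
    rw [h2, domainFunction_eq, ← hq, hq0] at h1
    rw [h3, h1]
    simp
  have he' := (eq_neg_laplacian_sub_iff v (p.2 - z ^ 2 • p.1) z).1 he
  rw [h0, smul_zero, sub_zero, hv0] at he'
  have hF : (𝓕 p.2 : L2Plane) = 0 := by
    rw [Lp.eq_zero_iff_ae_eq_zero]
    have hz0 : (𝓕 (0 : L2Plane) : L2Plane) = 0 := (Lp.fourierTransformₗᵢ Plane ℂ).map_zero
    rw [hz0] at he'
    filter_upwards [he', Lp.coeFn_zero ℂ 2 (volume : Measure Plane)] with ξ h1 h2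
    rw [h1, h2, Pi.zero_apply, mul_zero]
  rw [← norm_eq_zero, ← Lp.norm_fourier_eq, hF, norm_zero]

theorem symb_zero_ne_zero {ξ : Plane} (hξ : ξ ≠ 0) : symb 0 ξ ≠ 0 := by
  have hpi : (Real.pi : ℂ) ≠ 0 := by exact_mod_cast Real.pi_ne_zero
  simp [symb, hξ, hpi]

theorem symb_eq_symb_zero_sub (z : ℂ) (ξ : Plane) : symb z ξ = symb 0 ξ - z ^ 2 := by
  simp [symb]

/-- Take `v = ψ - G`, represented by `regularSum`. As `𝒟̃q = 0`, its values at the points are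
`Γ(z)q`, so `Γ(z)⁻¹` returns `q`; the equation is `symb z · (1/symb 0 - 1/symb z) = -z²/symb 0`. -/
theorem mem_pointInteractionGraphAt {α : Fin N → ℝ} {y : Fin N → Plane}
    (hy : Function.Injective y) {z : ℂ} (hz : z ∈ admissible α y) {q : Fin N → ℂ}
    (hD : Matrix.mulVec ((dMatrix α y).map Complex.ofReal) q = 0) {ψ : L2Plane}
    (hψ : (ψ : Plane → ℂ) =ᵐ[volume] logPotential y q)
    (hFψ : ((𝓕 ψ : L2Plane) : Plane → ℂ) =ᵐ[volume] fun ξ => expSum y q ξ / symb 0 ξ) :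
    (ψ, (0 : L2Plane)) ∈ pointInteractionGraphAt α y z := by
  set G : L2Plane := (memLp_greenSum hz.1 y q).toLp _ with hG
  have hv : ((ψ - G : L2Plane) : Plane → ℂ) =ᵐ[volume] regularSum y z q := by
    filter_upwards [Lp.coeFn_sub ψ G, hψ, (memLp_greenSum hz.1 y q).coeFn_toLp,
      ae_forall_ne y] with x h1 h2 h3 h4
    rw [h1, Pi.sub_apply, h2, hG, h3, regularSum_eq h4]
  have hcoef : Matrix.mulVec (gammaMatrix α y z)⁻¹ (fun k => regularSum y z q (y k)) = q := by
    have : (fun k => regularSum y z q (y k)) = Matrix.mulVec (gammaMatrix α y z) q := by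
      funext k
      rw [regularSum_apply_point α hy, hD, Pi.zero_apply, sub_zero]
    rw [this, Matrix.mulVec_mulVec, Matrix.nonsing_inv_mul _
      ((Matrix.isUnit_iff_isUnit_det _).1 hz.2), Matrix.one_mulVec]
  have hF : ((𝓕 ((0 : L2Plane) - z ^ 2 • ψ) : L2Plane) : Plane → ℂ) =ᵐ[volume]
      fun ξ => symb z ξ * (𝓕 (ψ - G) : L2Plane) ξ := by
    have e1 : (𝓕 ((0 : L2Plane) - z ^ 2 • ψ) : L2Plane) = -(z ^ 2 • (𝓕 ψ : L2Plane)) := by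
      rw [zero_sub]
      exact ((Lp.fourierTransformₗᵢ Plane ℂ).map_neg _).trans
        (congrArg _ ((Lp.fourierTransformₗᵢ Plane ℂ).map_smul _ _))
    have e2 : (𝓕 (ψ - G) : L2Plane) = (𝓕 ψ : L2Plane) - (𝓕 G : L2Plane) :=
      (Lp.fourierTransformₗᵢ Plane ℂ).map_sub _ _
    rw [e1, e2]
    filter_upwards [Lp.coeFn_neg (z ^ 2 • (𝓕 ψ : L2Plane)), Lp.coeFn_smul (z ^ 2) (𝓕 ψ : L2Plane),
      Lp.coeFn_sub (𝓕 ψ : L2Plane) (𝓕 G : L2Plane), hFψ, fourier_greenSum hz.1 y q,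
      ae_ne_zero_plane] with ξ h1 h2 h3 h4 h5 h6
    rw [h1, Pi.neg_apply, h2, Pi.smul_apply, h3, Pi.sub_apply, h4, hG, h5, smul_eq_mul]
    have hs := symb_ne_zero hz.1 ξ
    have hs0 := symb_zero_ne_zero h6
    have hs1 := symb_eq_symb_zero_sub z ξ
    field_simp
    rw [hs1]
    ring
  refine ⟨ψ - G, regularSum y z q, memSobolev_two_of_fourier_eq hF,
    continuous_regularSum hz.1 y q, hv, ?_, (eq_neg_laplacian_sub_iff _ _ z).2 hF⟩
  filter_upwards [hψ, ae_forall_ne y] with x h1 h2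
  rw [h1, domainFunction_eq, hcoef, regularSum_eq h2]
  ring

theorem exists_of_mem_pointInteractionGraphAt {α : Fin N → ℝ} {y : Fin N → Plane}
    (hy : Function.Injective y) {z : ℂ} (hz : z ∈ admissible α y) {ψ : L2Plane}
    (h : (ψ, (0 : L2Plane)) ∈ pointInteractionGraphAt α y z) :
    ∃ q : Fin N → ℂ, ∑ j, q j = 0 ∧ (∀ i : Fin 2, ∑ j, q j * ((y j i : ℝ) : ℂ) = 0) ∧
      Matrix.mulVec ((dMatrix α y).map Complex.ofReal) q = 0 ∧
      (ψ : Plane → ℂ) =ᵐ[volume] logPotential y q := by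
  obtain ⟨v, vc, -, hvc, hv, hu, he⟩ := h
  simp only at hu he
  set q := Matrix.mulVec (gammaMatrix α y z)⁻¹ (fun k => vc (y k)) with hq
  set G : L2Plane := (memLp_greenSum hz.1 y q).toLp _ with hG
  have hψ : ψ = v + G := by
    apply Lp.ext
    filter_upwards [hu, hv, Lp.coeFn_add v G, (memLp_greenSum hz.1 y q).coeFn_toLp]
      with x h1 h2 h3 h4
    rw [h1, h3, Pi.add_apply, h2, hG, h4, domainFunction_eq]
  -- Adding `symb z · v̂ = -z² ψ̂` to `symb z · Ĝ = E` gives `symb z · ψ̂ = -z² ψ̂ + E`, and `symb z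
  -- + z² = symb 0`.
  have hFeq : ∀ᵐ ξ, symb 0 ξ * (𝓕 ψ : L2Plane) ξ = expSum y q ξ := by
    have he' := (eq_neg_laplacian_sub_iff _ _ z).1 he
    have e1 : (𝓕 ((0 : L2Plane) - z ^ 2 • ψ) : L2Plane) = -(z ^ 2 • (𝓕 ψ : L2Plane)) := by
      rw [zero_sub]
      exact ((Lp.fourierTransformₗᵢ Plane ℂ).map_neg _).trans
        (congrArg _ ((Lp.fourierTransformₗᵢ Plane ℂ).map_smul _ _))
    have e2 : (𝓕 ψ : L2Plane) = (𝓕 v : L2Plane) + (𝓕 G : L2Plane) := by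
      rw [hψ]; exact (Lp.fourierTransformₗᵢ Plane ℂ).map_add _ _
    rw [e1] at he'
    have hadd := Lp.coeFn_add (𝓕 v : L2Plane) (𝓕 G : L2Plane)
    rw [← e2] at hadd
    filter_upwards [he', Lp.coeFn_neg (z ^ 2 • (𝓕 ψ : L2Plane)),
      Lp.coeFn_smul (z ^ 2) (𝓕 ψ : L2Plane), hadd, fourier_greenSum hz.1 y q] with ξ h0 h1 h2 h3 h4
    rw [h1, Pi.neg_apply, h2, Pi.smul_apply, smul_eq_mul] at h0
    rw [Pi.add_apply, hG, h4] at h3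
    have hs := symb_ne_zero hz.1 ξ
    have h5 : symb z ξ * (expSum y q ξ / symb z ξ) = expSum y q ξ := by field_simp
    have hs1 := symb_eq_symb_zero_sub z ξ
    linear_combination symb z ξ * h3 - h0 + h5 - (𝓕 ψ : L2Plane) ξ * hs1
  have hFψ : ((𝓕 ψ : L2Plane) : Plane → ℂ) =ᵐ[volume] fun ξ => expSum y q ξ / symb 0 ξ := by
    filter_upwards [hFeq, ae_ne_zero_plane] with ξ h1 h2
    rw [eq_div_iff (symb_zero_ne_zero h2), ← h1, mul_comm]
  have hmem : MemLp (fun ξ : Plane => expSum y q ξ / ((‖ξ‖ ^ 2 : ℝ) : ℂ)) 2 volume := by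
    refine ((Lp.memLp (𝓕 ψ : L2Plane)).const_mul (4 * (Real.pi : ℂ) ^ 2)).ae_eq ?_
    filter_upwards [hFψ, ae_ne_zero_plane] with ξ h1 h2
    have h3 : ((‖ξ‖ : ℝ) : ℂ) ≠ 0 := by exact_mod_cast (norm_pos_iff.2 h2).ne'
    have hpi : (Real.pi : ℂ) ≠ 0 := by exact_mod_cast Real.pi_ne_zero
    rw [h1, symb]
    push_cast
    field_simp
    ring
  obtain ⟨h0, h1⟩ := moments_eq_zero_of_memLp hmem
  obtain ⟨ψ', hψ', hFψ'⟩ := exists_fourier_logPotential h0 h1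
  have hψeq : ψ = ψ' := (Lp.fourierTransformₗᵢ Plane ℂ).injective
    (Lp.ext (hFψ.trans hFψ'.symm))
  rw [← hψeq] at hψ'
  refine ⟨q, h0, h1, ?_, hψ'⟩
  -- Both functions are continuous, so almost everywhere equality holds at every point, in
  -- particular at the `y k`.
  have hvreg : vc = regularSum y z q := by
    refine ((hvc.ae_eq_iff_eq volume (continuous_regularSum hz.1 y q)).1 ?_)
    filter_upwards [hu, hψ', ae_forall_ne y] with x h2 h3 h4
    rw [domainFunction_eq, h3] at h2
    rw [regularSum_eq h4, h2]
    ring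
  have hΓ : Matrix.mulVec (gammaMatrix α y z) q = fun k => vc (y k) := by
    rw [hq, Matrix.mulVec_mulVec, Matrix.mul_nonsing_inv _
      ((Matrix.isUnit_iff_isUnit_det _).1 hz.2), Matrix.one_mulVec]
  funext k
  have h2 := regularSum_apply_point α hy z q k
  rw [hΓ, ← hvreg] at h2
  rw [Pi.zero_apply]
  linear_combination h2

/-! ### Real and complex coefficients, and the main theorem -/

theorem mulVec_map_ofReal {m n : Type*} [Fintype n] (A : Matrix m n ℝ) (a : n → ℝ) :
    Matrix.mulVec (A.map Complex.ofReal) (fun j => (a j : ℂ))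
      = fun i => ((Matrix.mulVec A a i : ℝ) : ℂ) := by
  funext i
  simp [Matrix.mulVec, dotProduct]

theorem logPotential_im (y : Fin N → Plane) (c : Fin N → ℂ) (x : Plane) :
    logPotential y (fun j => ((c j).im : ℂ)) x = (((logPotential y c x).im : ℝ) : ℂ) := by
  have e : ∀ j, c j / (2 * (Real.pi : ℂ)) * ((Real.log ‖x - y j‖ : ℝ) : ℂ)
      = c j * ((Real.log ‖x - y j‖ / (2 * Real.pi) : ℝ) : ℂ) := fun j => by
    push_cast; ring
  simp only [logPotential, e, Complex.neg_im, Complex.im_sum, Complex.im_mul_ofReal]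
  push_cast
  refine congrArg _ (Finset.sum_congr rfl fun j _ => ?_)
  ring

end

theorem proposition1p2 {N : ℕ} (hN : 3 ≤ N) (α : Fin N → ℝ) (y : Fin N → Plane)
    (hy : Function.Injective y) :
    -- the function of a real vector `a` is a zero-energy eigenfunction
    (∀ a : Fin N → ℝ, a ≠ 0 → ∑ j, a j = 0 → ∑ j, a j • y j = 0 →
      Matrix.mulVec (dMatrix α y) a = 0 →
      ∃ ψ : L2Plane, (ψ : Plane → ℂ) =ᵐ[volume] logPotential y (fun j => (a j : ℂ)) ∧ ψ ≠ 0 ∧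
        ∃ hψ : ψ ∈ (pointInteraction α y).domain, pointInteraction α y ⟨ψ, hψ⟩ = 0) ∧
    -- every real zero-energy eigenfunction comes from a real vector
    (∀ (ψ : L2Plane) (hψ : ψ ∈ (pointInteraction α y).domain), ψ ≠ 0 →
      pointInteraction α y ⟨ψ, hψ⟩ = 0 → (∀ᵐ x, ((ψ : Plane → ℂ) x).im = 0) →
      ∃ a : Fin N → ℝ, a ≠ 0 ∧ ∑ j, a j = 0 ∧ ∑ j, a j • y j = 0 ∧
        Matrix.mulVec (dMatrix α y) a = 0 ∧
        (ψ : Plane → ℂ) =ᵐ[volume] logPotential y (fun j => (a j : ℂ))) ∧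
    -- every complex zero-energy eigenfunction comes from a complex vector
    (∀ (ψ : L2Plane) (hψ : ψ ∈ (pointInteraction α y).domain), ψ ≠ 0 →
      pointInteraction α y ⟨ψ, hψ⟩ = 0 →
      ∃ c : Fin N → ℂ, c ≠ 0 ∧ ∑ j, c j = 0 ∧ (∀ i : Fin 2, ∑ j, c j * ((y j i : ℝ) : ℂ) = 0) ∧
        Matrix.mulVec ((dMatrix α y).map Complex.ofReal) c = 0 ∧
        (ψ : Plane → ℂ) =ᵐ[volume] logPotential y c) := by
  -- `toLinearPMap` has the given submodule as graph only if it is single-valued. One admissible `z`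
  -- suffices, and one is needed: an empty infimum would be the whole space.
  have hfun : ∀ p ∈ ⨅ z ∈ admissible α y, pointInteractionGraphAt α y z, p.1 = 0 → p.2 = 0 := by
    obtain ⟨z, hz⟩ := admissible_nonempty α hy
    intro p hp
    exact eq_zero_of_mem_pointInteractionGraphAt hy hz
      ((Submodule.mem_iInf _).1 ((Submodule.mem_iInf _).1 hp z) hz)
  have hker : ∀ (ψ : L2Plane) (hψ : ψ ∈ (pointInteraction α y).domain), ψ ≠ 0 →
      pointInteraction α y ⟨ψ, hψ⟩ = 0 →
      ∃ c : Fin N → ℂ, c ≠ 0 ∧ ∑ j, c j = 0 ∧ (∀ i : Fin 2, ∑ j, c j * ((y j i : ℝ) : ℂ) = 0) ∧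
        Matrix.mulVec ((dMatrix α y).map Complex.ofReal) c = 0 ∧
        (ψ : Plane → ℂ) =ᵐ[volume] logPotential y c := by
    intro ψ hψ hne h0
    have hmem := Submodule.mem_graph_toLinearPMap hfun ⟨ψ, hψ⟩
    obtain ⟨z, hz⟩ := admissible_nonempty α hy
    have hmem' : (ψ, (0 : L2Plane)) ∈ pointInteractionGraphAt α y z := by
      rw [← h0]
      exact (Submodule.mem_iInf _).1 ((Submodule.mem_iInf _).1 hmem z) hz
    obtain ⟨q, h1, h2, h3, h4⟩ := exists_of_mem_pointInteractionGraphAt hy hz hmem'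
    refine ⟨q, fun hq => hne ?_, h1, h2, h3, h4⟩
    rw [Lp.eq_zero_iff_ae_eq_zero]
    filter_upwards [h4] with x hx
    rw [hx, hq]
    simp [logPotential]
  refine ⟨fun a ha h0 h1 hD => ?_, fun ψ hψ hne h0 hreal => ?_, hker⟩
  · have h0' : ∑ j, (a j : ℂ) = 0 := by exact_mod_cast h0
    have h1' : ∀ i : Fin 2, ∑ j, (a j : ℂ) * ((y j i : ℝ) : ℂ) = 0 := fun i => by
      have := congrArg (fun v : Plane => v i) h1
      simp only [WithLp.ofLp_sum, Finset.sum_apply, PiLp.smul_apply, smul_eq_mul,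
        PiLp.zero_apply] at this
      exact_mod_cast this
    have hD' : Matrix.mulVec ((dMatrix α y).map Complex.ofReal) (fun j => (a j : ℂ)) = 0 := by
      rw [mulVec_map_ofReal, hD]
      rfl
    obtain ⟨ψ, hψ, hFψ⟩ := exists_fourier_logPotential h0' h1'
    have hmem : (ψ, (0 : L2Plane)) ∈ ⨅ z ∈ admissible α y, pointInteractionGraphAt α y z :=
      (Submodule.mem_iInf _).2 fun z => (Submodule.mem_iInf _).2 fun hz =>
        mem_pointInteractionGraphAt hy hz hD' hψ hFψ
    refine ⟨ψ, hψ, fun hψ0 => ha ?_, ⟨(ψ, 0), hmem, rfl⟩, ?_⟩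
    · have := eq_zero_of_logPotential_ae_eq hy (f := fun _ => 0) continuous_const
        (q := fun j => (a j : ℂ)) (by
          rw [hψ0] at hψ
          exact hψ.symm.trans (Lp.coeFn_zero ℂ 2 (volume : Measure Plane)))
      funext j
      exact Complex.ofReal_eq_zero.1 (congrFun this j)
    -- Both `(ψ, Hψ)` and `(ψ, 0)` lie in the graph, so single-valuedness applies to their
    -- difference.
    · have h2 := Submodule.mem_graph_toLinearPMap hfun ⟨ψ, ⟨(ψ, 0), hmem, rfl⟩⟩
      have h3 := Submodule.sub_mem _ h2 hmem
      have h4 := hfun _ h3 (sub_self _)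
      simpa using! h4
  · obtain ⟨c, hc, h1, h2, h3, h4⟩ := hker ψ hψ hne h0
    -- The imaginary parts of `c` are the charges of `Im ψ = 0`, so they vanish.
    have him : (fun j => ((c j).im : ℂ)) = 0 := by
      refine eq_zero_of_logPotential_ae_eq hy (f := fun _ => 0) continuous_const ?_
      filter_upwards [h4, hreal] with x h5 h6
      rw [h5] at h6
      rw [logPotential_im, h6, Complex.ofReal_zero]
    have hcre : ∀ j, c j = ((c j).re : ℂ) := fun j => by
      have : (c j).im = 0 := Complex.ofReal_eq_zero.1 (congrFun him j)
      apply Complex.ext <;> simp [this]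
    have hcre' : c = fun j => ((c j).re : ℂ) := funext hcre
    refine ⟨fun j => (c j).re, fun h5 => hc ?_, ?_, ?_, ?_, ?_⟩
    · funext j
      rw [hcre j, show (c j).re = 0 from congrFun h5 j]
      rfl
    · have := congrArg Complex.re h1
      simpa using this
    · ext i
      have h5 := congrArg Complex.re (h2 i)
      simpa using h5
    · rw [hcre', mulVec_map_ofReal] at h3
      funext k
      exact Complex.ofReal_eq_zero.1 (congrFun h3 k)
    · rw [← hcre']
      exact h4
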